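/- Let $k,d$ be integers with $1\le k\le d$, and let $\mathbb{P}(\mathrm{Sym}^d((\mathbb{C}^4)^*))$, with its Zariski topology, be the projective space of surfaces of degree $d$ in $\mathbb{P}^3_{\mathbb{C}}$, i.e. of nonzero homogeneous polynomials $f$ of degree $d$ in four variables up to scaling. A surface $f$ contains a line $\ell$ with multiplicity $k$ (to order $k$) if $f\in I_\ell^k$, where $I_\ell\subset\mathbb{C}[x_1,x_2,x_3,x_4]$ is the ideal of polynomials vanishing on the two-dimensional subspace of $\mathbb{C}^4$ corresponding to $\ell$. Let $SingL_{k,d}$ be the set of surfaces of degree $d$ that contain some line with multiplicity $k$, and let $DoubL_{k,d}$ be the variety of surfaces of degree $d$ that contain two distinct lines with multiplicity $k$ each (if this set is not closed, its Zariski closure is meant; this does not change its dimension). If $d\ge 4$ or $k\ge 2$, then $$\dim(DoubL_{k,d})<\dim(SingL_{k,d}).$$ Hence a generic surface in $SingL_{k,d}$, i.e. every surface in some dense Zariski-open subset of $SingL_{k,d}$, contains exactly one line with multiplicity $k$. -/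

import Mathlib

open MvPolynomial

noncomputable section

namespace LineSurfaces

/-- Degree `d` surfaces in `ℙ³` over `ℂ`: points of the projectivization of the space of
homogeneous polynomials of degree `d` in four variables. -/
def Surface (d : ℕ) : Type :=
  Projectivization ℂ (homogeneousSubmodule (Fin 4) ℂ d)

/-- A homogeneous polynomial defining the surface (it is nonzero and unique up to scaling). -/
def Surface.equation {d : ℕ} (S : Surface d) : MvPolynomial (Fin 4) ℂ :=
  (Projectivization.rep S : homogeneousSubmodule (Fin 4) ℂ d)

/-- The exponents of the monomials of degree `d` in four variables. -/
abbrev Exponent (d : ℕ) : Type := {m : Fin 4 →₀ ℕ // m.degree = d}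

/-- The homogeneous coordinates of the surface in the projective space of all surfaces. -/
def Surface.coords {d : ℕ} (S : Surface d) : Exponent d → ℂ :=
  fun m => coeff m.1 S.equation

/-- The common zero set, in the projective space of surfaces, of a set of polynomials in the
homogeneous coordinates. It is used for homogeneous polynomials only. -/
def Surface.zeroLocus {d : ℕ} (T : Set (MvPolynomial (Exponent d) ℂ)) : Set (Surface d) :=
  {S | ∀ F ∈ T, eval S.coords F = 0}

/-- The Zariski topology on the projective space of surfaces: the closed sets are the common
zero sets of sets of homogeneous polynomials in the homogeneous coordinates. -/
instance Surface.zariskiTopology (d : ℕ) : TopologicalSpace (Surface d) :=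
  TopologicalSpace.ofClosed
    {Z | ∃ T : Set (MvPolynomial (Exponent d) ℂ),
      (∀ F ∈ T, ∃ n : ℕ, F.IsHomogeneous n) ∧ Z = Surface.zeroLocus T}
    (by
      refine ⟨{1}, ?_, ?_⟩
      · rintro F rfl
        exact ⟨0, isHomogeneous_one _ _⟩
      · ext S
        simp [Surface.zeroLocus])
    (by
      intro A hA
      have hA' : ∀ Z ∈ A, ∃ T : Set (MvPolynomial (Exponent d) ℂ),
          (∀ F ∈ T, ∃ n : ℕ, F.IsHomogeneous n) ∧ Z = Surface.zeroLocus T := fun Z hZ => hA hZ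
      choose! T hT hZ using hA'
      refine ⟨⋃ Z ∈ A, T Z, ?_, ?_⟩
      · intro F hF
        simp only [Set.mem_iUnion] at hF
        obtain ⟨Z, hZA, hF⟩ := hF
        exact hT Z hZA F hF
      · ext S
        simp only [Set.mem_sInter, Surface.zeroLocus, Set.mem_iUnion, Set.mem_ofPred_eq]
        constructor
        · rintro h F ⟨Z, hZA, hF⟩
          have := h Z hZA
          rw [hZ Z hZA] at this
          exact this F hF
        · intro h Z hZA
          rw [hZ Z hZA]
          exact fun F hF => h F ⟨Z, hZA, hF⟩)
    (by
      rintro _ ⟨T₁, h₁, rfl⟩ _ ⟨T₂, h₂, rfl⟩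
      refine ⟨{F | ∃ F₁ ∈ T₁, ∃ F₂ ∈ T₂, F = F₁ * F₂}, ?_, ?_⟩
      · rintro _ ⟨F₁, hF₁, F₂, hF₂, rfl⟩
        obtain ⟨n₁, hn₁⟩ := h₁ F₁ hF₁
        obtain ⟨n₂, hn₂⟩ := h₂ F₂ hF₂
        exact ⟨n₁ + n₂, hn₁.mul hn₂⟩
      · ext S
        simp only [Surface.zeroLocus, Set.mem_union, Set.mem_ofPred_eq]
        constructor
        · rintro (h | h) _ ⟨F₁, hF₁, F₂, hF₂, rfl⟩
          · simp [h F₁ hF₁]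
          · simp [h F₂ hF₂]
        · intro h
          by_contra! hc
          obtain ⟨⟨F₁, hF₁, hne₁⟩, F₂, hF₂, hne₂⟩ := hc
          have := h _ ⟨F₁, hF₁, F₂, hF₂, rfl⟩
          rw [map_mul] at this
          exact (mul_ne_zero hne₁ hne₂) this)

/-- A line in `ℙ³`, given as a two-dimensional linear subspace of `ℂ⁴`. -/
def IsLine (l : Submodule ℂ (Fin 4 → ℂ)) : Prop :=
  Module.finrank ℂ l = 2

/-- The surface contains the line `l` with multiplicity (at least) `k`: its equation vanishes on
`l` to order `k`, i.e. lies in the `k`-th power of the ideal of `l`. -/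
def Surface.ContainsToOrder {d : ℕ} (S : Surface d) (k : ℕ)
    (l : Submodule ℂ (Fin 4 → ℂ)) : Prop :=
  S.equation ∈ vanishingIdeal ℂ (l : Set (Fin 4 → ℂ)) ^ k

/-- Surfaces of degree `d` containing some line with multiplicity `k`. -/
def SingL (k d : ℕ) : Set (Surface d) :=
  {S | ∃ l, IsLine l ∧ S.ContainsToOrder k l}

/-- Surfaces of degree `d` containing two distinct lines with multiplicity `k` each. -/
def DoubL (k d : ℕ) : Set (Surface d) :=
  {S | ∃ l₁ l₂, IsLine l₁ ∧ IsLine l₂ ∧ l₁ ≠ l₂ ∧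
    S.ContainsToOrder k l₁ ∧ S.ContainsToOrder k l₂}

end LineSurfaces

end

/-! Let `N` be the number of monomials of degree `d` that have degree at least `k` in the first two
variables. In coordinates adapted to a `k`-fold line, the equation of a surface is a combination of
these `N` monomials, and lines depend on four parameters. After projectivizing, `N + 3` is the
expected dimension of `SingL k d`. The proof shows that this number is a lower bound there and a
strict upper bound for the closure of `DoubL k d`.

Upper bound: in coordinates adapted to two `k`-fold lines fewer monomials survive. Disjoint lines
cost 8 parameters but lose at least five monomials; meeting lines cost 7 and lose at least four; for
`k = d` the meeting case leaves only multiples of powers of one linear form. Each count gives at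
most `N + 3` affine parameters (`coveredByFamilies_doubL`). By `topologicalKrullDim_closure_lt` this
bounds the dimension: chains of irreducible closed sets become chains of prime cone ideals above the
kernel of a map to a polynomial ring, where Noether normalization applies. The ideal of the origin
lengthens each chain by one, which makes the bound strict.

Lower bound: the `N` coefficients and the four parameters of a chart of lines are switched on one at
a time. The closures of the images grow strictly (`le_topologicalKrullDim`), because suitable
coordinates have an invertible Jacobian at `X 0 ^ k * X 2 ^ (d - k) + X 1 ^ k * X 3 ^ (d - k)`
(`jacobian_genParam`).

Uniqueness: `SingL k d` is irreducible, being the image of one family (`singL_eq_paramSet`). The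
complement of the closure of `DoubL k d` is nonempty in it by dimension, hence dense. -/

namespace LineSurfaces

/-! ### Krull dimension, algebraic relations and the Jacobian criterion. -/

/-- A finitely generated algebra that embeds into a polynomial ring in `n` variables has Krull
dimension at most `n`. -/
theorem ringKrullDim_le_card_of_injective {K A σ : Type} [Field K] [CommRing A] [Algebra K A]
    [Algebra.FiniteType K A] [Finite σ] (f : A →ₐ[K] MvPolynomial σ K)
    (hf : Function.Injective f) : ringKrullDim A ≤ Nat.card σ := by
  have : Nontrivial A := f.toRingHom.domain_nontrivial
  have : IsDomain A := hf.isDomain f.toRingHom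
  -- Noether normalization; transcendence degree then bounds the number `s` of its variables.
  obtain ⟨s, g, hg, hint⟩ := exists_integral_inj_algHom_of_fg K A
  have hs : s ≤ Nat.card σ := by
    have hinj : Function.Injective (f.comp g) := hf.comp hg
    have h := lift_trdeg_le_of_injective (f.comp g) hinj
    rw [MvPolynomial.trdeg_of_isDomain, MvPolynomial.trdeg_of_isDomain] at h
    have : Fintype σ := Fintype.ofFinite σ
    simpa using h
  let _ : Algebra (MvPolynomial (Fin s) K) A := g.toRingHom.toAlgebra
  have hI : Algebra.IsIntegral (MvPolynomial (Fin s) K) A := ⟨hint⟩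
  have hle : ringKrullDim A ≤ ringKrullDim (MvPolynomial (Fin s) K) := by
    -- Incomparability: contraction along an integral extension keeps inclusions of primes strict.
    refine Order.krullDim_le_of_strictMono
      (PrimeSpectrum.comap (algebraMap (MvPolynomial (Fin s) K) A)) ?_
    intro p q hpq
    exact Ideal.IsIntegral.comap_lt_comap hpq
  refine hle.trans ?_
  rw [MvPolynomial.ringKrullDim_of_isNoetherianRing, ringKrullDim_eq_zero_of_field]
  simpa using hs

/-- A strictly decreasing chain of primes above the kernel of a map to a polynomial ring in `n`
variables has length at most `n`. -/
theorem chain_length_le_of_ker_le {κ σ : Type} [Finite κ] [Finite σ]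
    (ψ : MvPolynomial κ ℂ →ₐ[ℂ] MvPolynomial σ ℂ) {r : ℕ}
    (P : Fin (r + 1) → Ideal (MvPolynomial κ ℂ))
    (hP : ∀ i, (P i).IsPrime) (hanti : StrictAnti P)
    (h : ∀ i, RingHom.ker ψ ≤ P i) : r ≤ Nat.card σ := by
  have h1 : ringKrullDim (MvPolynomial κ ℂ ⧸ RingHom.ker ψ) ≤ Nat.card σ :=
    ringKrullDim_le_card_of_injective (Ideal.kerLiftAlg ψ) (Ideal.kerLiftAlg_injective ψ)
  rw [ringKrullDim_quotient] at h1
  let r' : LTSeries (PrimeSpectrum.zeroLocus (RingHom.ker ψ : Set (MvPolynomial κ ℂ))) :=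
    LTSeries.mk r (fun i => ⟨⟨P i.rev, hP _⟩, h _⟩) fun i j hij => hanti (Fin.rev_lt_rev.2 hij)
  have h2 := (Order.LTSeries.length_le_krullDim r').trans h1
  exact_mod_cast h2

/-- Polynomials in fewer variables than their number satisfy a polynomial relation. -/
theorem exists_aeval_eq_zero_of_card_lt {σ τ : Type} [Finite σ] [Finite τ]
    (ψ : σ → MvPolynomial τ ℂ) (h : Nat.card τ < Nat.card σ) :
    ∃ F : MvPolynomial σ ℂ, F ≠ 0 ∧ aeval ψ F = 0 := by
  have hn : ¬ AlgebraicIndependent ℂ ψ := by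
    intro hi
    have h1 := hi.lift_cardinalMk_le_trdeg
    rw [MvPolynomial.trdeg_of_isDomain] at h1
    have : Fintype σ := Fintype.ofFinite σ
    have : Fintype τ := Fintype.ofFinite τ
    simp only [Cardinal.mk_fintype, Cardinal.lift_natCast, Nat.cast_le] at h1
    simp only [Nat.card_eq_fintype_card] at h
    omega
  rw [algebraicIndependent_iff] at hn
  push Not at hn
  obtain ⟨F, h1, h2⟩ := hn
  exact ⟨F, h2, h1⟩

/-- The value of a polynomial at a point with coordinates in the dual numbers. -/
theorem aeval_dualNumber {σ : Type} [Fintype σ] (F : MvPolynomial σ ℂ) (q : σ → DualNumber ℂ) :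
    (aeval q F).fst = eval (fun s => (q s).fst) F ∧
    (aeval q F).snd = ∑ s, (q s).snd * eval (fun s => (q s).fst) (pderiv s F) := by
  induction F using MvPolynomial.induction_on with
  | C a => simp [TrivSqZeroExt.algebraMap_eq_inl]
  | add F G hF hG =>
    simp only [map_add, TrivSqZeroExt.fst_add, TrivSqZeroExt.snd_add, hF.1, hG.1, hF.2, hG.2,
      mul_add, Finset.sum_add_distrib, and_self]
  | mul_X F i hF =>
    classical
    constructor
    · simp [hF.1]
    · simp only [map_mul, aeval_X, TrivSqZeroExt.snd_mul, hF.1, hF.2, Derivation.leibniz,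
        pderiv_X, smul_eq_mul, map_add, eval_X, mul_add, Finset.sum_add_distrib]
      simp [Pi.single_apply, Finset.mul_sum, apply_ite, mul_comm, mul_left_comm]

theorem eq_C_of_pderiv_eq_zero {σ : Type} (F : MvPolynomial σ ℂ) (h : ∀ i, pderiv i F = 0) :
    F = C (coeff 0 F) := by
  classical
  ext m
  rw [coeff_C]
  split_ifs with hm
  · rw [hm]
  · obtain ⟨i, hi⟩ : ∃ i, m i ≠ 0 := by
      by_contra! hc
      exact hm (Finsupp.ext fun i => (hc i).symm)
    have h1 := coeff_pderiv (i := i) F (m - Finsupp.single i 1)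
    have hle : Finsupp.single i 1 ≤ m := by
      rw [Finsupp.single_le_iff]
      omega
    rw [h i, coeff_zero, tsub_add_cancel_of_le hle] at h1
    rcases mul_eq_zero.1 h1.symm with h2 | h2
    · exact h2
    · exact absurd h2 (by norm_cast)

theorem totalDegree_pderiv_lt {σ : Type} (F : MvPolynomial σ ℂ) (i : σ) {n : ℕ}
    (hF : F.totalDegree ≤ n + 1) : (pderiv i F).totalDegree ≤ n := by
  refine Finset.sup_le fun m hm => ?_
  rw [mem_support_iff, coeff_pderiv] at hm
  have h1 := le_totalDegree (mem_support_iff.2 (left_ne_zero_of_mul hm))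
  change (m + Finsupp.single i 1).degree ≤ _ at h1
  rw [map_add, Finsupp.degree_single] at h1
  change m.degree ≤ n
  omega

theorem eval_aeval_eq {σ τ : Type} (ψ : σ → MvPolynomial τ ℂ) (p : τ → ℂ) (F : MvPolynomial σ ℂ) :
    eval p (aeval ψ F) = eval (fun s => eval p (ψ s)) F := by
  rw [← MvPolynomial.coe_aeval_eq_eval, ← MvPolynomial.coe_aeval_eq_eval]
  simp only [RingHom.coe_coe]
  rw [← AlgHom.comp_apply, comp_aeval]

/-- The Jacobian criterion: polynomials whose Jacobian matrix is diagonal and invertible at some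
point are algebraically independent. -/
theorem eq_zero_of_aeval_eq_zero_of_jacobian {σ : Type} [Fintype σ] [DecidableEq σ]
    (ψ : σ → MvPolynomial σ ℂ) (p c : σ → ℂ) (hc : ∀ s, c s ≠ 0)
    (hJ : ∀ i j, eval p (pderiv j (ψ i)) = if i = j then c i else 0)
    (F : MvPolynomial σ ℂ) (hF : aeval ψ F = 0) : F = 0 := by
  have chain (F : MvPolynomial σ ℂ) (j : σ) :
      pderiv j (aeval ψ F) = ∑ i, pderiv j (ψ i) * aeval ψ (pderiv i F) := by
    induction F using MvPolynomial.induction_on with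
    | C a => simp
    | add F G hF hG => simp only [map_add, hF, hG, mul_add, Finset.sum_add_distrib]
    | mul_X F i hF =>
      simp only [map_mul, aeval_X, Derivation.leibniz, hF, pderiv_X, smul_eq_mul, map_add, mul_add,
        Finset.sum_add_distrib]
      simp [Pi.single_apply, Finset.mul_sum, apply_ite, mul_comm, mul_left_comm]
  -- The determinant is a nonzero polynomial because its value at `p` is the product of the `c s`.
  have hdet : (Matrix.of fun j i => pderiv j (ψ i)).det ≠ 0 := by
    intro h0
    have h1 := congrArg (eval p) h0
    rw [RingHom.map_det, map_zero] at h1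
    have : (eval p).mapMatrix (Matrix.of fun j i => pderiv j (ψ i)) = Matrix.diagonal c := by
      ext j i
      simp only [RingHom.mapMatrix_apply, Matrix.map_apply, Matrix.of_apply, hJ,
        Matrix.diagonal_apply]
      by_cases hij : i = j
      · simp [hij]
      · simp [hij, Ne.symm hij]
    rw [this, Matrix.det_diagonal] at h1
    exact Finset.prod_ne_zero_iff.2 (fun s _ => hc s) h1
  -- Induction on the degree of a relation: by the chain rule the invertible Jacobian kills the
  -- vector of its partial derivatives at `ψ`, so these are relations of smaller degree, hence zero,
  -- and the relation is constant.
  have key (n : ℕ) : ∀ F : MvPolynomial σ ℂ, aeval ψ F = 0 → F.totalDegree ≤ n → F = 0 := by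
    have hconst (F : MvPolynomial σ ℂ) (hF : aeval ψ F = 0) (h : F = C (coeff 0 F)) : F = 0 := by
      rw [h] at hF ⊢
      simpa using hF
    induction n with
    | zero =>
      intro F hF hd
      exact hconst F hF (totalDegree_eq_zero_iff_eq_C.1 (Nat.le_zero.1 hd))
    | succ n ih =>
      intro F hF hd
      have hvec : (fun i => aeval ψ (pderiv i F)) = 0 := by
        refine Matrix.eq_zero_of_mulVec_eq_zero hdet ?_
        ext1 j
        have := chain F j
        rw [hF, map_zero] at this
        simp only [Matrix.mulVec, dotProduct, Matrix.of_apply, Pi.zero_apply]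
        exact this.symm
      exact hconst F hF (eq_C_of_pderiv_eq_zero F fun i =>
        ih _ (congrFun hvec i) (totalDegree_pderiv_lt F i hd))
  exact key _ F hF le_rfl

/-! ### Coordinates of surfaces and ideals of cones. -/

instance (d : ℕ) : Finite (Exponent d) := (Finsupp.finite_of_degree_eq d).to_subtype

noncomputable instance (d : ℕ) : Fintype (Exponent d) := Fintype.ofFinite _

variable {d : ℕ}

theorem Surface.equation_isHomogeneous (S : Surface d) : S.equation.IsHomogeneous d :=
  (mem_homogeneousSubmodule _ _).1 (Projectivization.rep S).2

theorem Surface.equation_ne_zero (S : Surface d) : S.equation ≠ 0 := fun h =>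
  Projectivization.rep_nonzero S (Subtype.ext h)

theorem Surface.exists_coords_ne_zero (S : Surface d) : ∃ m, S.coords m ≠ 0 := by
  obtain ⟨m, hm⟩ := ne_zero_iff.1 S.equation_ne_zero
  refine ⟨⟨m, ?_⟩, hm⟩
  have := S.equation_isHomogeneous hm
  rw [Finsupp.degree_eq_weight_one]
  exact this

/-- The homogeneous polynomial of degree `d` with given coefficients. -/
noncomputable def ofCoords {R : Type} [CommRing R] (x : Exponent d → R) : MvPolynomial (Fin 4) R :=
  ∑ m, monomial m.1 (x m)

theorem coeff_ofCoords {R : Type} [CommRing R] (x : Exponent d → R) (m : Exponent d) :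
    coeff m.1 (ofCoords x) = x m := by
  classical
  simp only [ofCoords, coeff_sum, coeff_monomial]
  rw [Finset.sum_eq_single m]
  · simp
  · intro b _ hb
    rw [if_neg]
    exact fun h => hb (Subtype.ext h)
  · simp

theorem ofCoords_isHomogeneous {R : Type} [CommRing R] (x : Exponent d → R) :
    (ofCoords x).IsHomogeneous d :=
  IsHomogeneous.sum _ _ _ fun m _ => isHomogeneous_monomial _ m.2

theorem ofCoords_coeff {R : Type} [CommRing R] {f : MvPolynomial (Fin 4) R}
    (hf : f.IsHomogeneous d) : ofCoords (fun m : Exponent d => coeff m.1 f) = f := by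
  ext m
  by_cases hm : m.degree = d
  · exact coeff_ofCoords _ ⟨m, hm⟩
  · rw [(ofCoords_isHomogeneous _).coeff_eq_zero hm, hf.coeff_eq_zero hm]

/-- A nonzero homogeneous polynomial defines a surface. -/
theorem exists_surface {f : MvPolynomial (Fin 4) ℂ} (hf : f.IsHomogeneous d) (h0 : f ≠ 0) :
    ∃ (S : Surface d) (t : ℂ), t ≠ 0 ∧ S.equation = t • f := by
  have h0' : (⟨f, (mem_homogeneousSubmodule _ _).2 hf⟩ : homogeneousSubmodule (Fin 4) ℂ d) ≠ 0 :=
    fun h => h0 (congrArg Subtype.val h)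
  obtain ⟨a, ha⟩ := Projectivization.exists_smul_eq_mk_rep ℂ _ h0'
  exact ⟨Projectivization.mk ℂ _ h0', a, a.ne_zero, (congrArg Subtype.val ha).symm⟩

/-- The scalar `t` is unavoidable, since `equation` is a chosen representative of the projective
point. -/
theorem exists_surface_coords (x : Exponent d → ℂ) (hx : ∃ m, x m ≠ 0) :
    ∃ (S : Surface d) (t : ℂ), t ≠ 0 ∧ S.coords = t • x := by
  obtain ⟨m, hm⟩ := hx
  obtain ⟨S, t, ht, hS⟩ := exists_surface (ofCoords_isHomogeneous x) (fun h => hm (by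
    rw [← coeff_ofCoords x m, h, coeff_zero]))
  refine ⟨S, t, ht, funext fun m => ?_⟩
  rw [Surface.coords, hS, coeff_smul, coeff_ofCoords, Pi.smul_apply]

theorem eval_smul_of_isHomogeneous {κ : Type} {F : MvPolynomial κ ℂ} {n : ℕ}
    (hF : F.IsHomogeneous n) (x : κ → ℂ) (t : ℂ) : eval (t • x) F = t ^ n * eval x F := by
  rw [eval_eq, eval_eq, Finset.mul_sum]
  refine Finset.sum_congr rfl fun m hm => ?_
  have hdeg : ∑ i ∈ m.support, m i = n := by
    have := hF (mem_support_iff.1 hm)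
    rw [← this]
    exact (DFunLike.congr_fun Finsupp.degree_eq_weight_one m)
  simp only [Pi.smul_apply, smul_eq_mul, mul_pow, Finset.prod_mul_distrib]
  rw [Finset.prod_pow_eq_pow_sum, hdeg]
  ring

theorem eval_smul_eq_sum {κ : Type} (F : MvPolynomial κ ℂ) (x : κ → ℂ) (t : ℂ) :
    eval (t • x) F = ∑ i ∈ Finset.range (F.totalDegree + 1),
      t ^ i * eval x (homogeneousComponent i F) := by
  conv_lhs => rw [← sum_homogeneousComponent F]
  rw [map_sum]
  exact Finset.sum_congr rfl fun i _ => 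
    eval_smul_of_isHomogeneous (homogeneousComponent_isHomogeneous i F) x t

/-- On the line through `x`, `F` is a polynomial in `t` whose coefficients are the values of the
homogeneous components; vanishing for every complex `t`, it is zero. -/
theorem eval_homogeneousComponent_eq_zero {κ : Type} (F : MvPolynomial κ ℂ) (x : κ → ℂ)
    (h : ∀ t : ℂ, eval (t • x) F = 0) (n : ℕ) : eval x (homogeneousComponent n F) = 0 := by
  by_cases hn : F.totalDegree < n
  · rw [homogeneousComponent_eq_zero _ _ hn, map_zero]
  set q : Polynomial ℂ := ∑ i ∈ Finset.range (F.totalDegree + 1),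
    Polynomial.monomial i (eval x (homogeneousComponent i F)) with hq
  have hq0 : q = 0 := by
    refine Polynomial.funext fun t => ?_
    rw [hq, Polynomial.eval_finsetSum, Polynomial.eval_zero, ← h t, eval_smul_eq_sum]
    exact Finset.sum_congr rfl fun i _ => by rw [Polynomial.eval_monomial, mul_comm]
  have h1 : q.coeff n = 0 := by rw [hq0, Polynomial.coeff_zero]
  rw [hq, Polynomial.finsetSum_coeff] at h1
  simpa [Polynomial.coeff_monomial, Nat.lt_succ_iff, not_lt.1 hn] using h1

theorem Surface.isClosed_iff (Z : Set (Surface d)) :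
    IsClosed Z ↔ ∃ T : Set (MvPolynomial (Exponent d) ℂ),
      (∀ F ∈ T, ∃ n : ℕ, F.IsHomogeneous n) ∧ Z = Surface.zeroLocus T := by
  rw [← isOpen_compl_iff]
  change Zᶜᶜ ∈ _ ↔ _
  rw [compl_compl]
  rfl

/-- The ideal of polynomials vanishing on the cone over a set of surfaces. -/
noncomputable def coneIdeal (A : Set (Surface d)) : Ideal (MvPolynomial (Exponent d) ℂ) where
  carrier := {F | ∀ S ∈ A, ∀ t : ℂ, eval (t • S.coords) F = 0}
  add_mem' {F G} hF hG S hS t := by rw [map_add, hF S hS t, hG S hS t, add_zero]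
  zero_mem' S _ t := map_zero _
  smul_mem' F G hG S hS t := by rw [smul_eq_mul, map_mul, hG S hS t, mul_zero]

theorem mem_coneIdeal_of_isHomogeneous {A : Set (Surface d)} {F : MvPolynomial (Exponent d) ℂ}
    {n : ℕ} (hF : F.IsHomogeneous n) (h : ∀ S ∈ A, eval S.coords F = 0) : F ∈ coneIdeal A := by
  intro S hS t
  rw [eval_smul_of_isHomogeneous hF, h S hS, mul_zero]

theorem eval_coords_eq_zero {A : Set (Surface d)} {F : MvPolynomial (Exponent d) ℂ}
    (hF : F ∈ coneIdeal A) {S : Surface d} (hS : S ∈ A) : eval S.coords F = 0 := by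
  simpa using hF S hS 1

theorem homogeneousComponent_mem_coneIdeal {A : Set (Surface d)} {F : MvPolynomial (Exponent d) ℂ}
    (hF : F ∈ coneIdeal A) (n : ℕ) : homogeneousComponent n F ∈ coneIdeal A :=
  mem_coneIdeal_of_isHomogeneous (homogeneousComponent_isHomogeneous n F) fun S hS =>
    eval_homogeneousComponent_eq_zero F _ (hF S hS) n

theorem coneIdeal_anti {A B : Set (Surface d)} (h : A ⊆ B) : coneIdeal B ≤ coneIdeal A :=
  fun _ hF S hS => hF S (h hS)

/-- The closure is cut out by homogeneous polynomials vanishing on `A`, and these lie in the cone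
ideal. -/
theorem mem_closure_of_coneIdeal {A : Set (Surface d)} {S : Surface d}
    (h : ∀ F ∈ coneIdeal A, eval S.coords F = 0) : S ∈ closure A := by
  obtain ⟨T, hT, hZ⟩ := (Surface.isClosed_iff _).1 (isClosed_closure (s := A))
  rw [hZ]
  intro F hF
  obtain ⟨n, hn⟩ := hT F hF
  refine h F (mem_coneIdeal_of_isHomogeneous hn fun S' hS' => ?_)
  have : S' ∈ Surface.zeroLocus T := hZ ▸ subset_closure hS'
  exact this F hF

theorem isClosed_zeroLocus_coneIdeal (A : Set (Surface d)) :
    IsClosed {S : Surface d | ∀ F ∈ coneIdeal A, ∀ t : ℂ, eval (t • S.coords) F = 0} := by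
  rw [Surface.isClosed_iff]
  refine ⟨{F | F ∈ coneIdeal A ∧ ∃ n : ℕ, F.IsHomogeneous n}, fun F hF => hF.2, ?_⟩
  ext S
  constructor
  · rintro h F ⟨hF, -⟩
    simpa using h F hF 1
  · intro h F hF t
    rw [eval_smul_eq_sum]
    refine Finset.sum_eq_zero fun i _ => ?_
    rw [h _ ⟨homogeneousComponent_mem_coneIdeal hF i, i, homogeneousComponent_isHomogeneous i F⟩,
      mul_zero]

theorem coneIdeal_closure (A : Set (Surface d)) : coneIdeal (closure A) = coneIdeal A := by
  refine le_antisymm (coneIdeal_anti subset_closure) fun F hF S hS => ?_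
  have : closure A ⊆ {S : Surface d | ∀ F ∈ coneIdeal A, ∀ t : ℂ, eval (t • S.coords) F = 0} :=
    closure_minimal (fun S hS F hF t => hF S hS t) (isClosed_zeroLocus_coneIdeal A)
  exact this hS F hF

/-- The ideal is homogeneous, so primality need only be tested on homogeneous `F` and `G`. If their
product vanishes on `A`, then `A` is covered by two closed hypersurfaces and lies in one of them. -/
theorem coneIdeal_isPrime {A : Set (Surface d)} (hA : IsIrreducible A) : (coneIdeal A).IsPrime := by
  let _ : GradedAlgebra (homogeneousSubmodule (Exponent d) ℂ) := gradedAlgebra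
  refine Ideal.IsHomogeneous.isPrime_of_homogeneous_mem_or_mem
    (𝒜 := homogeneousSubmodule (Exponent d) ℂ) ?_ ?_ ?_
  · intro n F hF
    exact (decomposition.decompose'_apply F n).symm ▸ homogeneousComponent_mem_coneIdeal hF n
  · intro h
    obtain ⟨S, hS⟩ := hA.nonempty
    have h1 : (1 : MvPolynomial (Exponent d) ℂ) ∈ coneIdeal A := h ▸ Submodule.mem_top
    simpa using h1 S hS 1
  · rintro F G ⟨m, hm⟩ ⟨n, hn⟩ hFG
    have hm' : F.IsHomogeneous m := hm
    have hn' : G.IsHomogeneous n := hn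
    have hclosed {F : MvPolynomial (Exponent d) ℂ} {n : ℕ} (hF : F.IsHomogeneous n) :
        IsClosed {S : Surface d | eval S.coords F = 0} := by
      rw [Surface.isClosed_iff]
      exact ⟨{F}, fun _ h => ⟨n, h ▸ hF⟩, by simp [Surface.zeroLocus]⟩
    have h1 := isPreirreducible_iff_isClosed_union_isClosed.1 hA.isPreirreducible _ _
      (hclosed hm') (hclosed hn') (fun S hS => by
        have := eval_coords_eq_zero hFG hS
        rw [map_mul] at this
        exact mul_eq_zero.1 this)
    exact h1.imp (fun h => mem_coneIdeal_of_isHomogeneous hm' h)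
      (fun h => mem_coneIdeal_of_isHomogeneous hn' h)

/-! ### Parametrized families and their dimensions. -/

/-- The surfaces whose coordinates are values of the given polynomials. -/
def paramSet {σ : Type} (ψ : Exponent d → MvPolynomial σ ℂ) : Set (Surface d) :=
  {S | ∃ v, ∀ m, S.coords m = eval v (ψ m)}

/-- The image of the given polynomials is stable under scaling. -/
def ScaleStable {σ : Type} (ψ : Exponent d → MvPolynomial σ ℂ) : Prop :=
  ∀ (v : σ → ℂ) (t : ℂ), ∃ v', ∀ m, eval v' (ψ m) = t * eval v (ψ m)

/-- Scale stability makes the image of the parametrization contain the whole cone over the family.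
-/
theorem mem_coneIdeal_paramSet {σ : Type} {ψ : Exponent d → MvPolynomial σ ℂ}
    (hψ : ScaleStable ψ) {F : MvPolynomial (Exponent d) ℂ} (hF : aeval ψ F = 0) :
    F ∈ coneIdeal (paramSet ψ) := by
  rintro S ⟨v, hv⟩ t
  obtain ⟨v', hv'⟩ := hψ v t
  have : t • S.coords = fun m => eval v' (ψ m) := by
    ext m
    rw [hv' m, ← hv m, Pi.smul_apply, smul_eq_mul]
  rw [this, ← eval_aeval_eq, hF, map_zero]

theorem exists_mem_paramSet {σ : Type} {ψ : Exponent d → MvPolynomial σ ℂ} (hψ : ScaleStable ψ)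
    (v : σ → ℂ) (hv : ∃ m, eval v (ψ m) ≠ 0) :
    ∃ S ∈ paramSet ψ, ∃ t : ℂ, t ≠ 0 ∧ S.coords = t • fun m => eval v (ψ m) := by
  obtain ⟨S, t, ht, hS⟩ := exists_surface_coords (fun m => eval v (ψ m)) hv
  obtain ⟨v', hv'⟩ := hψ v t
  refine ⟨S, ⟨v', fun m => ?_⟩, t, ht, hS⟩
  rw [hS, hv' m, Pi.smul_apply, smul_eq_mul]

theorem eq_zero_of_eval_eq_zero {σ : Type} {F G : MvPolynomial σ ℂ} (hG : G ≠ 0)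
    (h : ∀ v, eval v G ≠ 0 → eval v F = 0) : F = 0 := by
  have : F * G = 0 := MvPolynomial.funext fun v => by
    rw [map_mul, map_zero]
    by_cases hv : eval v G = 0
    · rw [hv, mul_zero]
    · rw [h v hv, zero_mul]
  exact (mul_eq_zero.1 this).resolve_right hG

/-- Parameter values with `ψ m` nonzero give actual surfaces, where `F` vanishes. A polynomial
vanishing off a proper hypersurface is zero. -/
theorem aeval_eq_zero_of_mem_coneIdeal {σ : Type} {ψ : Exponent d → MvPolynomial σ ℂ}
    (hψ : ScaleStable ψ) (hne : ∃ m, ψ m ≠ 0) {F : MvPolynomial (Exponent d) ℂ}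
    (hF : F ∈ coneIdeal (paramSet ψ)) : aeval ψ F = 0 := by
  obtain ⟨m, hm⟩ := hne
  refine eq_zero_of_eval_eq_zero hm fun v hv => ?_
  obtain ⟨S, hS, t, ht, hSt⟩ := exists_mem_paramSet hψ v ⟨m, hv⟩
  -- Scaling by `t⁻¹` undoes the choice of representative.
  have := hF S hS t⁻¹
  rwa [hSt, smul_smul, inv_mul_cancel₀ ht, one_smul, ← eval_aeval_eq] at this

/-- If two closed sets cover the family without either containing it, equations of the two that are
nonzero on the family have a product vanishing on it, which is impossible in the polynomial ring of
parameters, a domain. -/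
theorem isPreirreducible_paramSet {σ : Type} {ψ : Exponent d → MvPolynomial σ ℂ}
    (hψ : ScaleStable ψ) : IsPreirreducible (paramSet ψ) := by
  rw [isPreirreducible_iff_isClosed_union_isClosed]
  intro Z₁ Z₂ h₁ h₂ hsub
  by_contra! hc
  simp only [Set.not_subset] at hc
  obtain ⟨⟨S₁, hS₁, hn₁⟩, S₂, hS₂, hn₂⟩ := hc
  have key {Z : Set (Surface d)} (hZ : IsClosed Z) {S : Surface d} (hS : S ∈ paramSet ψ)
      (hn : S ∉ Z) : ∃ F ∈ coneIdeal Z, aeval ψ F ≠ 0 := by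
    have h := mt mem_closure_of_coneIdeal (hZ.closure_eq.symm ▸ hn)
    push Not at h
    obtain ⟨F, hF, hne⟩ := h
    obtain ⟨v, hv⟩ := hS
    refine ⟨F, hF, fun h0 => hne ?_⟩
    have : S.coords = fun m => eval v (ψ m) := funext hv
    rw [this, ← eval_aeval_eq, h0, map_zero]
  obtain ⟨F₁, hF₁, hne₁⟩ := key h₁ hS₁ hn₁
  obtain ⟨F₂, hF₂, hne₂⟩ := key h₂ hS₂ hn₂
  have hF : F₁ * F₂ ∈ coneIdeal (paramSet ψ) := by
    intro S hS t
    rcases hsub hS with h | h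
    · rw [map_mul, hF₁ S h t, zero_mul]
    · rw [map_mul, hF₂ S h t, mul_zero]
  have hne : ∃ m, ψ m ≠ 0 := by
    obtain ⟨v, hv⟩ := hS₁
    obtain ⟨m, hm⟩ := S₁.exists_coords_ne_zero
    exact ⟨m, fun h0 => hm (by rw [hv, h0, map_zero])⟩
  have := aeval_eq_zero_of_mem_coneIdeal hψ hne hF
  rw [map_mul] at this
  exact (mul_ne_zero hne₁ hne₂) this

/-- A set of surfaces covered by finitely many families with at most `n` affine parameters has
dimension less than `n`. -/
theorem topologicalKrullDim_closure_lt {A : Set (Surface d)} {J : Type} [Finite J]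
    {σ : J → Type} [∀ j, Finite (σ j)] (ψ : ∀ j, Exponent d → MvPolynomial (σ j) ℂ) (n : ℕ)
    (hn : ∀ j, Nat.card (σ j) ≤ n) (hψ : ∀ j, ScaleStable (ψ j))
    (hA : ∀ S ∈ A, ∃ j, S ∈ paramSet (ψ j)) :
    topologicalKrullDim (closure A) < n := by
  classical
  have : Fintype J := Fintype.ofFinite J
  rw [topologicalKrullDim, Order.krullDim_lt_coe_iff]
  intro l
  let Z (i : Fin (l.length + 1)) : TopologicalSpace.IrreducibleCloseds (Surface d) :=
    TopologicalSpace.IrreducibleCloseds.map _ continuous_subtype_val (l i)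
  have hZmono : StrictMono Z := fun i j hij =>
    TopologicalSpace.IrreducibleCloseds.map_strictMono_of_isInducing
      Topology.IsInducing.subtypeVal (l.strictMono hij)
  have hZA (i) : (Z i : Set (Surface d)) ⊆ closure A := by
    rw [TopologicalSpace.IrreducibleCloseds.coe_map]
    refine closure_minimal ?_ isClosed_closure
    rintro _ ⟨x, -, rfl⟩
    exact x.2
  -- The ideal of the origin is put on top of the cone ideals; this extra prime turns the bound for
  -- the affine cone into a strict one for the projective set.
  let P : Fin (l.length + 1 + 1) → Ideal (MvPolynomial (Exponent d) ℂ) :=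
    Fin.cons (RingHom.ker (eval (0 : Exponent d → ℂ))) fun i => coneIdeal (Z i : Set (Surface d))
  have hPprime (i) : (P i).IsPrime := by
    refine Fin.cases ?_ (fun i => ?_) i
    · exact RingHom.ker_isPrime _
    · exact coneIdeal_isPrime (Z i).isIrreducible
  have hanti : StrictAnti P := by
    rw [Fin.strictAnti_iff_succ_lt]
    intro i
    refine Fin.cases ?_ (fun i => ?_) i
    · change coneIdeal (Z 0 : Set (Surface d)) < RingHom.ker (eval (0 : Exponent d → ℂ))
      obtain ⟨S, hS⟩ := (Z 0).isIrreducible.nonempty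
      refine lt_of_le_of_ne (fun F hF => ?_) fun h => ?_
      · simpa using hF S hS 0
      · obtain ⟨m, hm⟩ := S.exists_coords_ne_zero
        have : X m ∈ RingHom.ker (eval (0 : Exponent d → ℂ)) := by simp
        rw [← h] at this
        exact hm (by simpa using eval_coords_eq_zero this hS)
    · change coneIdeal (Z i.succ : Set (Surface d)) < coneIdeal (Z i.castSucc : Set (Surface d))
      have hlt := hZmono (Fin.castSucc_lt_succ (i := i))
      refine lt_of_le_of_ne (coneIdeal_anti hlt.le) fun h => hlt.not_ge fun S hS => ?_
      have h1 : S ∈ closure (Z i.castSucc : Set (Surface d)) :=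
        mem_closure_of_coneIdeal fun F hF => eval_coords_eq_zero (h ▸ hF) hS
      rwa [(Z i.castSucc).isClosed.closure_eq] at h1
  have hinf : (Finset.univ.inf fun j => RingHom.ker (aeval (ψ j) :
      MvPolynomial (Exponent d) ℂ →ₐ[ℂ] MvPolynomial (σ j) ℂ)) ≤ P (Fin.last _) := by
    intro F hF
    have hF' (j) : aeval (ψ j) F = 0 := by
      have := (Finset.inf_le (Finset.mem_univ j) :
        (Finset.univ.inf fun j => RingHom.ker (aeval (ψ j) :
          MvPolynomial (Exponent d) ℂ →ₐ[ℂ] MvPolynomial (σ j) ℂ)) ≤ _) hF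
      exact this
    have hFA : F ∈ coneIdeal A := fun S hS => by
      obtain ⟨j, hj⟩ := hA S hS
      exact mem_coneIdeal_paramSet (hψ j) (hF' j) S hj
    rw [← coneIdeal_closure] at hFA
    rw [← Fin.succ_last]
    exact coneIdeal_anti (hZA _) hFA
  -- A prime containing a finite intersection contains one member; as the smallest prime lies above
  -- this kernel, so does the whole chain.
  obtain ⟨j, -, hj⟩ := ((hPprime (Fin.last _)).inf_le' ).1 hinf
  have := chain_length_le_of_ker_le (aeval (ψ j)) P hPprime hanti fun i =>
    hj.trans (hanti.antitone (Fin.le_last i))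
  have := hn j
  omega

theorem isPreirreducible_preimage_val {X : Type} [TopologicalSpace X] {A B : Set X} (hBA : B ⊆ A)
    (hB : IsPreirreducible B) : IsPreirreducible (Subtype.val ⁻¹' B : Set A) := by
  rintro _ _ ⟨U, hU, rfl⟩ ⟨V, hV, rfl⟩ ⟨x, hxB, hxU⟩ ⟨y, hyB, hyV⟩
  obtain ⟨z, hzB, hz⟩ := hB U V hU hV ⟨x, hxB, hxU⟩ ⟨y, hyB, hyV⟩
  exact ⟨⟨z, hBA hzB⟩, hzB, hz⟩

/-- A chain of families with `1, …, N + 1` essential parameters bounds the dimension of a set of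
surfaces from below. -/
theorem le_topologicalKrullDim {A : Set (Surface d)} (N : ℕ) {σ : Fin (N + 1) → Type}
    [∀ i, Finite (σ i)] (ψ : ∀ i, Exponent d → MvPolynomial (σ i) ℂ)
    (hcard : ∀ i, Nat.card (σ i) = i + 1) (hψ : ∀ i, ScaleStable (ψ i))
    (hsub : ∀ i, paramSet (ψ i) ⊆ A)
    (hmono : ∀ i : Fin N, paramSet (ψ i.castSucc) ⊆ paramSet (ψ i.succ))
    (hindep : ∀ i, ∃ c : σ i → Exponent d, ∀ F : MvPolynomial (σ i) ℂ,
      aeval (fun s => ψ i (c s)) F = 0 → F = 0) :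
    N ≤ topologicalKrullDim A := by
  have hne (i) : ∃ m, ψ i m ≠ 0 := by
    obtain ⟨c, hc⟩ := hindep i
    have : Nonempty (σ i) := (Nat.card_pos_iff.1 (by rw [hcard]; omega)).1
    refine ⟨c (Classical.arbitrary _), fun h => ?_⟩
    exact X_ne_zero (R := ℂ) (Classical.arbitrary (σ i)) (hc _ (by rw [aeval_X, h]))
  have hirr (i) : IsIrreducible (Subtype.val ⁻¹' paramSet (ψ i) : Set A) := by
    constructor
    · obtain ⟨m, hm⟩ := hne i
      obtain ⟨v, hv⟩ : ∃ v, eval v (ψ i m) ≠ 0 := by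
        by_contra! hc
        exact hm (MvPolynomial.funext fun v => by rw [hc v, map_zero])
      obtain ⟨S, hS, -⟩ := exists_mem_paramSet (hψ i) v ⟨m, hv⟩
      exact ⟨⟨S, hsub i hS⟩, hS⟩
    · exact isPreirreducible_preimage_val (hsub i) (isPreirreducible_paramSet (hψ i))
  let C (i : Fin (N + 1)) : TopologicalSpace.IrreducibleCloseds A :=
    ⟨closure (Subtype.val ⁻¹' paramSet (ψ i)), (hirr i).closure, isClosed_closure⟩
  have hC : StrictMono C := by
    rw [Fin.strictMono_iff_lt_succ]
    intro i
    refine lt_of_le_not_ge ?_ fun h => ?_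
    · exact closure_mono (Set.preimage_mono (hmono i))
    have hsub' : paramSet (ψ i.succ) ⊆ closure (paramSet (ψ i.castSucc)) := by
      intro S hS
      have h1 : (⟨S, hsub _ hS⟩ : A) ∈ closure (Subtype.val ⁻¹' paramSet (ψ i.castSucc) : Set A) :=
        h (subset_closure hS)
      rw [closure_subtype] at h1
      exact closure_mono (Set.image_preimage_subset _ _) h1
    obtain ⟨c, hc⟩ := hindep i.succ
    -- If step `i` were not strict, the `i + 2` coordinates independent on the larger family would
    -- satisfy the relation that they satisfy on the smaller one, which has only `i + 1` parameters.
    obtain ⟨F, hF0, hF⟩ := exists_aeval_eq_zero_of_card_lt (fun s => ψ i.castSucc (c s)) (by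
      rw [hcard, hcard]
      simp)
    refine hF0 (hc F ?_)
    have hmem : rename c F ∈ coneIdeal (paramSet (ψ i.castSucc)) :=
      mem_coneIdeal_paramSet (hψ _) (by rw [aeval_rename]; exact hF)
    rw [← coneIdeal_closure] at hmem
    have := aeval_eq_zero_of_mem_coneIdeal (hψ _) (hne _) (coneIdeal_anti hsub' hmem)
    rwa [aeval_rename] at this
  exact Order.LTSeries.length_le_krullDim (LTSeries.mk N C hC)

/-! ### Linear substitutions. -/

section LinearSubstitution

variable {R : Type} [CommRing R]

/-- The linear form with given coefficients. -/
noncomputable def linForm (a : Fin 4 → R) : MvPolynomial (Fin 4) R := ∑ j, C (a j) * X j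

/-- Substitution of the linear forms given by the rows of a matrix. -/
noncomputable def linSub (A : Matrix (Fin 4) (Fin 4) R) :
    MvPolynomial (Fin 4) R →ₐ[R] MvPolynomial (Fin 4) R :=
  aeval fun i => linForm (A i)

theorem linSub_X (A : Matrix (Fin 4) (Fin 4) R) (i : Fin 4) : linSub A (X i) = linForm (A i) :=
  aeval_X _ _

theorem linForm_isHomogeneous (a : Fin 4 → R) : (linForm a).IsHomogeneous 1 :=
  IsHomogeneous.sum _ _ _ fun j _ => by
    simpa using (isHomogeneous_C (Fin 4) (a j)).mul (isHomogeneous_X R j)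

theorem linSub_isHomogeneous (A : Matrix (Fin 4) (Fin 4) R) {f : MvPolynomial (Fin 4) R}
    (hf : f.IsHomogeneous d) : (linSub A f).IsHomogeneous d := by
  have := hf.aeval (fun i => linForm (A i)) fun i => linForm_isHomogeneous (A i)
  rwa [one_mul] at this

theorem linSub_linForm (A : Matrix (Fin 4) (Fin 4) R) (b : Fin 4 → R) :
    linSub A (linForm b) = linForm (Matrix.vecMul b A) := by
  have h (j : Fin 4) : linSub A (C (b j) * X j) = ∑ i, C (b j * A j i) * X i := by
    rw [linSub, map_mul, aeval_C, aeval_X, algebraMap_eq, linForm, Finset.mul_sum]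
    exact Finset.sum_congr rfl fun i _ => by rw [C_mul, mul_assoc]
  have h1 : linForm (Matrix.vecMul b A) = ∑ i, ∑ j, C (b j * A j i) * X i := by
    unfold linForm
    refine Finset.sum_congr rfl fun i _ => ?_
    rw [← Finset.sum_mul, ← map_sum]
    rfl
  have h2 : linSub A (linForm b) = ∑ j, linSub A (C (b j) * X j) :=
    map_sum (linSub A) (fun j => C (b j) * X j) Finset.univ
  have h3 : ∑ j, linSub A (C (b j) * X j) = ∑ j, ∑ i, C (b j * A j i) * X i :=
    Finset.sum_congr rfl fun j _ => h j
  exact h2.trans (h3.trans (Finset.sum_comm.trans h1.symm))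

theorem linForm_single (i : Fin 4) : linForm (Pi.single i (1 : R)) = X i := by
  simp [linForm, Pi.single_apply, apply_ite]

theorem linSub_linSub (A B : Matrix (Fin 4) (Fin 4) R) (f : MvPolynomial (Fin 4) R) :
    linSub A (linSub B f) = linSub (B * A) f := by
  have h : (linSub A).comp (linSub B) = linSub (B * A) := MvPolynomial.algHom_ext fun i => by
    rw [AlgHom.comp_apply, linSub_X, linSub_X, linSub_linForm, Matrix.mul_apply_eq_vecMul]
  exact DFunLike.congr_fun h f

theorem linSub_one (f : MvPolynomial (Fin 4) R) : linSub 1 f = f := by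
  have : linSub (1 : Matrix (Fin 4) (Fin 4) R) = AlgHom.id R _ := by
    refine MvPolynomial.algHom_ext fun i => ?_
    rw [linSub, aeval_X, AlgHom.id_apply, ← linForm_single]
    congr 1
    funext j
    rw [Matrix.one_apply, Pi.single_apply]
    simp only [eq_comm]
  rw [this, AlgHom.id_apply]

theorem eval_linForm (a v : Fin 4 → R) : eval v (linForm a) = a ⬝ᵥ v := by
  simp [linForm, dotProduct]

theorem eval_linSub (A : Matrix (Fin 4) (Fin 4) R) (v : Fin 4 → R) (f : MvPolynomial (Fin 4) R) :
    eval v (linSub A f) = eval (Matrix.mulVec A v) f := by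
  induction f using MvPolynomial.induction_on with
  | C a => simp [linSub]
  | add f g hf hg => rw [map_add, map_add, map_add, hf, hg]
  | mul_X f i hf =>
    rw [map_mul, map_mul, map_mul, hf, eval_X, linSub, aeval_X, eval_linForm]
    rfl

theorem map_linForm {S : Type} [CommRing S] (φ : R →+* S) (a : Fin 4 → R) :
    map φ (linForm a) = linForm fun j => φ (a j) := by
  simp [linForm]

theorem map_linSub {S : Type} [CommRing S] (φ : R →+* S) (A : Matrix (Fin 4) (Fin 4) R)
    (f : MvPolynomial (Fin 4) R) : map φ (linSub A f) = linSub (A.map φ) (map φ f) := by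
  induction f using MvPolynomial.induction_on with
  | C a => simp [linSub]
  | add f g hf hg => simp only [map_add, hf, hg]
  | mul_X f i hf =>
    rw [map_mul, map_mul, map_mul, map_mul, hf, map_X]
    simp only [linSub, aeval_X, map_linForm]
    rfl

theorem linSub_monomial (A : Matrix (Fin 4) (Fin 4) R) (m : Fin 4 →₀ ℕ) (c : R) :
    linSub A (monomial m c) = C c * ∏ i, linForm (A i) ^ m i := by
  rw [linSub, aeval_monomial, algebraMap_eq, Finsupp.prod_fintype]
  simp

end LinearSubstitution

/-! ### Order of vanishing along a line, in adapted coordinates. -/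

/-- The ideal of polynomials all of whose monomials have degree at least `k` in the variables
`X i` and `X j`. -/
noncomputable def orderIdeal (i j : Fin 4) (k : ℕ) : Ideal (MvPolynomial (Fin 4) ℂ) where
  carrier := {f | ∀ m, coeff m f ≠ 0 → k ≤ m i + m j}
  add_mem' {f g} hf hg m hm := by
    by_cases h : coeff m f = 0
    · exact hg m fun h' => hm (by rw [coeff_add, h, h', add_zero])
    · exact hf m h
  zero_mem' m hm := absurd (coeff_zero m) hm
  smul_mem' f g hg m hm := by
    classical
    rw [smul_eq_mul, coeff_mul] at hm
    obtain ⟨⟨a, b⟩, hab, hne⟩ := Finset.exists_ne_zero_of_sum_ne_zero hm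
    have h1 := hg b (right_ne_zero_of_mul hne)
    rw [Finset.HasAntidiagonal.mem_antidiagonal] at hab
    simp only [← hab, Finsupp.add_apply]
    omega

theorem orderIdeal_pow_le (i j : Fin 4) (k : ℕ) : orderIdeal i j 1 ^ k ≤ orderIdeal i j k := by
  classical
  induction k with
  | zero => exact fun f _ m _ => Nat.zero_le _
  | succ k ih =>
    rw [pow_succ]
    refine (Ideal.mul_mono_left ih).trans (Ideal.mul_le.2 fun f hf g hg m hm => ?_)
    rw [coeff_mul] at hm
    obtain ⟨⟨a, b⟩, hab, hne⟩ := Finset.exists_ne_zero_of_sum_ne_zero hm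
    have h1 := hf a (left_ne_zero_of_mul hne)
    have h2 := hg b (right_ne_zero_of_mul hne)
    rw [Finset.HasAntidiagonal.mem_antidiagonal] at hab
    simp only [← hab, Finsupp.add_apply]
    omega

/-- Setting `X i` and `X j` to zero does not change `g` modulo the ideal and, by hypothesis, makes
it vanish at every point. -/
theorem mem_orderIdeal_one {i j : Fin 4} {g : MvPolynomial (Fin 4) ℂ}
    (hg : ∀ p : Fin 4 → ℂ, p i = 0 → p j = 0 → eval p g = 0) : g ∈ orderIdeal i j 1 := by
  let ρ : MvPolynomial (Fin 4) ℂ →ₐ[ℂ] MvPolynomial (Fin 4) ℂ :=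
    aeval fun s => if s = i ∨ s = j then 0 else X s
  have hρ : ρ g = 0 := MvPolynomial.funext fun p => by
    rw [map_zero, eval_aeval_eq]
    exact hg _ (by simp) (by simp)
  have hmem : g - ρ g ∈ orderIdeal i j 1 := by
    rw [← Ideal.Quotient.eq]
    have : (Ideal.Quotient.mkₐ ℂ (orderIdeal i j 1)) =
        (Ideal.Quotient.mkₐ ℂ (orderIdeal i j 1)).comp ρ := by
      refine MvPolynomial.algHom_ext fun s => ?_
      rw [AlgHom.comp_apply, aeval_X]
      split_ifs with hs
      · rw [map_zero, Ideal.Quotient.mkₐ_eq_mk, Ideal.Quotient.eq_zero_iff_mem]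
        intro m hm
        rw [coeff_X] at hm
        have hm' : Finsupp.single s 1 = m := by
          by_contra h
          exact hm (if_neg h)
        rcases hs with rfl | rfl <;> simp [← hm']
      · rfl
    exact DFunLike.congr_fun this g
  rwa [hρ, sub_zero] at hmem

/-- A polynomial vanishing to order `k` on a line has, in coordinates adapted to the line, only
monomials of degree at least `k` in the two forms defining the line. -/
theorem linSub_inv_mem_orderIdeal {A : Matrix (Fin 4) (Fin 4) ℂ} (hA : IsUnit A.det) {i j : Fin 4}
    {l : Submodule ℂ (Fin 4 → ℂ)} (hl : ∀ v, A i ⬝ᵥ v = 0 → A j ⬝ᵥ v = 0 → v ∈ l) {k : ℕ}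
    {f : MvPolynomial (Fin 4) ℂ} (hf : f ∈ vanishingIdeal ℂ (l : Set (Fin 4 → ℂ)) ^ k) :
    linSub A⁻¹ f ∈ orderIdeal i j k := by
  have h1 : vanishingIdeal ℂ (l : Set (Fin 4 → ℂ)) ≤ (orderIdeal i j 1).comap (linSub A⁻¹) := by
    intro h hh
    refine mem_orderIdeal_one fun p hpi hpj => ?_
    rw [eval_linSub]
    have hp : A.mulVec (A⁻¹.mulVec p) = p := by
      rw [Matrix.mulVec_mulVec, Matrix.mul_nonsing_inv _ hA, Matrix.one_mulVec]
    have := mem_vanishingIdeal_iff.1 hh (A⁻¹.mulVec p) (hl _ ((congrFun hp i).trans hpi)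
      ((congrFun hp j).trans hpj))
    rwa [MvPolynomial.aeval_eq_eval] at this
  have h2 : f ∈ ((orderIdeal i j 1).comap (linSub A⁻¹)) ^ k := Ideal.pow_right_mono h1 k hf
  exact orderIdeal_pow_le i j k (Ideal.le_comap_pow _ k h2)

theorem linSub_linSub_inv {A : Matrix (Fin 4) (Fin 4) ℂ} (hA : IsUnit A.det)
    (f : MvPolynomial (Fin 4) ℂ) : linSub A (linSub A⁻¹ f) = f := by
  rw [linSub_linSub, Matrix.nonsing_inv_mul _ hA, linSub_one]

/-- Each monomial of `g` becomes a multiple of a product of at least `k` copies of the two forms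
vanishing on `l`. The forms need not be independent. -/
theorem linSub_mem_vanishingIdeal_pow {A : Matrix (Fin 4) (Fin 4) ℂ} {i j : Fin 4} (hij : i ≠ j)
    {l : Submodule ℂ (Fin 4 → ℂ)} (hl : ∀ v ∈ l, A i ⬝ᵥ v = 0 ∧ A j ⬝ᵥ v = 0) {k : ℕ}
    {g : MvPolynomial (Fin 4) ℂ} (hg : g ∈ orderIdeal i j k) :
    linSub A g ∈ vanishingIdeal ℂ (l : Set (Fin 4 → ℂ)) ^ k := by
  rw [g.as_sum, map_sum]
  refine Ideal.sum_mem _ fun m hm => ?_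
  have hk := hg m (mem_support_iff.1 hm)
  rw [linSub_monomial]
  refine Ideal.mul_mem_left _ _ ?_
  have hmem {s : Fin 4} (hs : ∀ v ∈ l, A s ⬝ᵥ v = 0) :
      linForm (A s) ∈ vanishingIdeal ℂ (l : Set (Fin 4 → ℂ)) := by
    rw [mem_vanishingIdeal_iff]
    intro v hv
    rw [MvPolynomial.aeval_eq_eval]
    exact (eval_linForm _ _).trans (hs v hv)
  rw [← Finset.mul_prod_erase _ _ (Finset.mem_univ i),
    ← Finset.mul_prod_erase _ _ (Finset.mem_erase.2 ⟨hij.symm, Finset.mem_univ j⟩), ← mul_assoc]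
  refine Ideal.mul_mem_right _ _ (Ideal.pow_le_pow_right hk ?_)
  rw [pow_add]
  exact Ideal.mul_mem_mul (Ideal.pow_mem_pow (hmem fun v hv => (hl v hv).1) _)
    (Ideal.pow_mem_pow (hmem fun v hv => (hl v hv).2) _)

noncomputable instance (M : Set (Exponent d)) : Fintype M := Fintype.ofFinite _

/-! ### Polynomials in moving linear forms. -/

/-- The family of polynomials with monomials in `M`, in linear forms depending on parameters. -/
noncomputable def genParam {τ : Type} (A : Matrix (Fin 4) (Fin 4) (MvPolynomial τ ℂ))
    (M : Set (Exponent d)) (n : Exponent d) : MvPolynomial (τ ⊕ M) ℂ :=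
  coeff n.1 (linSub (A.map (rename Sum.inl)) (∑ m : M, monomial m.1.1 (X (Sum.inr m))))

/-- A general algebra `S` is allowed so that the formula serves complex parameters and also dual
numbers, which compute the Jacobian. -/
theorem aeval_genParam {τ S : Type} [CommRing S] [Algebra ℂ S]
    (A : Matrix (Fin 4) (Fin 4) (MvPolynomial τ ℂ)) (M : Set (Exponent d)) (n : Exponent d)
    (q : τ ⊕ M → S) :
    aeval q (genParam A M n) = coeff n.1 (linSub (A.map (aeval fun t => q (Sum.inl t)))
      (∑ m : M, monomial m.1.1 (q (Sum.inr m)))) := by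
  have h := coeff_map (aeval q : MvPolynomial (τ ⊕ M) ℂ →ₐ[ℂ] S).toRingHom
    (linSub (A.map (rename Sum.inl)) (∑ m : M, monomial m.1.1 (X (Sum.inr m)))) n.1
  rw [map_linSub, map_sum] at h
  refine h.symm.trans ?_
  have h1 : (A.map (rename Sum.inl : MvPolynomial τ ℂ → MvPolynomial (τ ⊕ M) ℂ)).map
      (aeval q : MvPolynomial (τ ⊕ M) ℂ →ₐ[ℂ] S).toRingHom =
      A.map (aeval fun t => q (Sum.inl t)) := by
    ext i j
    exact aeval_rename _ _ _
  rw [h1]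
  congr 2
  refine Finset.sum_congr rfl fun m _ => ?_
  rw [map_monomial]
  congr 1
  exact aeval_X _ _

theorem eval_genParam {τ : Type}
    (A : Matrix (Fin 4) (Fin 4) (MvPolynomial τ ℂ)) (M : Set (Exponent d)) (n : Exponent d)
    (q : τ ⊕ M → ℂ) :
    eval q (genParam A M n) = coeff n.1 (linSub (A.map (eval fun t => q (Sum.inl t)))
      (∑ m : M, monomial m.1.1 (q (Sum.inr m)))) := by
  have := aeval_genParam A M n q
  simpa only [aeval_eq_eval] using this

theorem eval_genParam_scale {τ : Type} (A : Matrix (Fin 4) (Fin 4) (MvPolynomial τ ℂ))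
    (M : Set (Exponent d)) (v : τ ⊕ M → ℂ) (t : ℂ) (n : Exponent d) :
    eval (Sum.elim (fun s => v (Sum.inl s)) fun m => t * v (Sum.inr m)) (genParam A M n) =
      t * eval v (genParam A M n) := by
  rw [eval_genParam, eval_genParam, ← smul_eq_mul, ← coeff_smul, ← map_smul, Finset.smul_sum]
  simp only [smul_monomial, Sum.elim_inl, Sum.elim_inr, smul_eq_mul]

theorem genParam_scaleStable {τ : Type} (A : Matrix (Fin 4) (Fin 4) (MvPolynomial τ ℂ))
    (M : Set (Exponent d)) : ScaleStable (genParam A M) :=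
  fun v t => ⟨_, eval_genParam_scale A M v t⟩

theorem mem_paramSet_genParam {τ : Type} {A : Matrix (Fin 4) (Fin 4) (MvPolynomial τ ℂ)}
    {M : Set (Exponent d)} {S : Surface d} :
    S ∈ paramSet (genParam A M) ↔ ∃ (a : τ → ℂ) (g : MvPolynomial (Fin 4) ℂ), g.IsHomogeneous d ∧
      (∀ m : Exponent d, coeff m.1 g ≠ 0 → m ∈ M) ∧ S.equation = linSub (A.map (eval a)) g := by
  classical
  constructor
  · rintro ⟨v, hv⟩
    have hg : (∑ m : M, monomial m.1.1 (v (Sum.inr m))).IsHomogeneous d :=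
      IsHomogeneous.sum _ _ _ fun m _ => isHomogeneous_monomial _ m.1.2
    refine ⟨fun t => v (Sum.inl t), ∑ m : M, monomial m.1.1 (v (Sum.inr m)), hg, ?_, ?_⟩
    · intro m hm
      rw [coeff_sum] at hm
      obtain ⟨n, -, hn⟩ := Finset.exists_ne_zero_of_sum_ne_zero hm
      rw [coeff_monomial] at hn
      have : n.1.1 = m.1 := by
        by_contra h
        exact hn (if_neg h)
      exact Subtype.ext this ▸ n.2
    · rw [← ofCoords_coeff S.equation_isHomogeneous, ← ofCoords_coeff (linSub_isHomogeneous _ hg)]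
      congr 1
      funext m
      rw [← eval_genParam]
      exact hv m
  · rintro ⟨a, g, hg, hM, hS⟩
    refine ⟨Sum.elim a fun m => coeff m.1.1 g, fun n => ?_⟩
    rw [eval_genParam, Surface.coords, hS]
    have h : g = ∑ m : M, monomial m.1.1 (coeff m.1.1 g) := by
      conv_lhs => rw [← ofCoords_coeff hg, ofCoords]
      rw [← Finset.sum_subtype (Finset.univ.filter (· ∈ M)) (by simp)
        fun m : Exponent d => monomial m.1 (coeff m.1 g)]
      refine (Finset.sum_filter_of_ne fun m _ hm => hM m fun h0 => hm ?_).symm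
      rw [h0, monomial_zero]
    exact congrArg (fun f => coeff n.1 (linSub (A.map (eval a)) f)) h

/-! ### Linear forms adapted to one or two lines. -/

/-- The space of linear forms vanishing on a subspace of `ℂ⁴`. -/
noncomputable def perp (W : Submodule ℂ (Fin 4 → ℂ)) : Submodule ℂ (Fin 4 → ℂ) :=
  (Matrix.toBilin' (1 : Matrix (Fin 4) (Fin 4) ℂ)).orthogonal W

theorem mem_perp {W : Submodule ℂ (Fin 4 → ℂ)} {v : Fin 4 → ℂ} :
    v ∈ perp W ↔ ∀ w ∈ W, w ⬝ᵥ v = 0 := by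
  simp [perp, LinearMap.BilinForm.mem_orthogonal_iff, Matrix.toBilin'_apply']

theorem nondegenerate_dotProduct :
    (Matrix.toBilin' (1 : Matrix (Fin 4) (Fin 4) ℂ)).Nondegenerate :=
  Matrix.Nondegenerate.toBilin' (Matrix.nondegenerate_of_det_ne_zero (by simp))

theorem finrank_perp (W : Submodule ℂ (Fin 4 → ℂ)) :
    Module.finrank ℂ (perp W) = 4 - Module.finrank ℂ W := by
  rw [perp, LinearMap.BilinForm.finrank_orthogonal nondegenerate_dotProduct]
  simp

theorem perp_perp (W : Submodule ℂ (Fin 4 → ℂ)) : perp (perp W) = W := by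
  refine LinearMap.BilinForm.orthogonal_orthogonal nondegenerate_dotProduct (fun v w h => ?_) W
  rw [Matrix.toBilin'_apply', Matrix.one_mulVec] at h ⊢
  rw [dotProduct_comm, h]

/-- A line contained in the zero set of two linear forms. -/
theorem exists_isLine (a b : Fin 4 → ℂ) :
    ∃ l, IsLine l ∧ ∀ v ∈ l, a ⬝ᵥ v = 0 ∧ b ⬝ᵥ v = 0 := by
  have h1 : Module.finrank ℂ (Submodule.span ℂ {a, b}) ≤ 2 := by
    classical
    have := finrank_span_finset_le_card (R := ℂ) ({a, b} : Finset (Fin 4 → ℂ))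
    rw [Finset.coe_pair] at this
    exact this.trans Finset.card_le_two
  have h2 : 1 < Module.finrank ℂ (perp (Submodule.span ℂ {a, b})) := by
    rw [finrank_perp]
    omega
  have : Nontrivial (perp (Submodule.span ℂ {a, b})) :=
    Module.nontrivial_of_finrank_pos (R := ℂ) (by omega)
  -- The forms may be dependent and their common zeros more than a line, so two independent vectors
  -- are chosen among these zeros.
  obtain ⟨x, hx⟩ := exists_ne (0 : perp (Submodule.span ℂ {a, b}))
  obtain ⟨y, hxy⟩ := exists_linearIndependent_pair_of_one_lt_finrank h2 hx
  have hli := hxy.map' (Submodule.subtype _) (Submodule.ker_subtype _)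
  refine ⟨Submodule.span ℂ (Set.range (Submodule.subtype _ ∘ ![x, y])), ?_, fun v hv => ?_⟩
  · rw [IsLine, finrank_span_eq_card hli, Fintype.card_fin]
  · have hle : Submodule.span ℂ (Set.range (Submodule.subtype _ ∘ ![x, y])) ≤
        perp (Submodule.span ℂ {a, b}) := by
      rw [Submodule.span_le]
      rintro _ ⟨i, rfl⟩
      exact Subtype.property _
    have hv' := mem_perp.1 (hle hv)
    exact ⟨hv' a (Submodule.subset_span (by simp)), hv' b (Submodule.subset_span (by simp))⟩

theorem pair_eq_zero {u w : Fin 4 → ℂ} {i j : Fin 4} (hui : u i = 1)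
    (hwi : w i = 0) (hwj : w j = 1) {a b : ℂ} (h : a • u + b • w = 0) : a = 0 ∧ b = 0 := by
  have h1 := congrFun h i
  have h2 := congrFun h j
  simp only [Pi.add_apply, Pi.smul_apply, smul_eq_mul, hui, hwi, hwj, Pi.zero_apply] at h1 h2
  have hs : a = 0 := by simpa using h1
  subst hs
  exact ⟨rfl, by simpa using h2⟩

theorem eq_span_pair {V : Submodule ℂ (Fin 4 → ℂ)} (hV : Module.finrank ℂ V = 2)
    {u w : Fin 4 → ℂ} (hu : u ∈ V) (hw : w ∈ V) {i j : Fin 4} (hui : u i = 1)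
    (hwi : w i = 0) (hwj : w j = 1) : V = Submodule.span ℂ {u, w} := by
  symm
  have hle : Submodule.span ℂ {u, w} ≤ V := by
    rw [Submodule.span_le]
    rintro x (rfl | rfl)
    exacts [hu, hw]
  refine Submodule.eq_of_le_of_finrank_eq hle ?_
  have hli : LinearIndependent ℂ ![u, w] := by
    rw [LinearIndependent.pair_iff]
    exact fun s t h => pair_eq_zero hui hwi hwj h
  have := finrank_span_eq_card hli
  rw [Fintype.card_fin, Matrix.range_cons_cons_empty] at this
  rw [this, hV]

/-- One step of Gaussian elimination: subtract from a vector outside the span of `u` its multiple of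
`u`, then normalize a nonzero coordinate. -/
theorem exists_second_form {V : Submodule ℂ (Fin 4 → ℂ)} (hV : Module.finrank ℂ V = 2)
    {u : Fin 4 → ℂ} {i : Fin 4} (hui : u i = 1) (hu : u ∈ V) :
    ∃ j ≠ i, ∃ w ∈ V, w i = 0 ∧ w j = 1 := by
  obtain ⟨w, hwV, hw⟩ : ∃ w ∈ V, w ∉ Submodule.span ℂ {u} := by
    by_contra! hc
    have h1 := Submodule.finrank_mono (show V ≤ Submodule.span ℂ {u} from hc)
    have h2 := finrank_span_finset_le_card (R := ℂ) ({u} : Finset (Fin 4 → ℂ))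
    rw [Finset.coe_singleton, Finset.card_singleton] at h2
    have h3 := hV.symm.le.trans (h1.trans h2)
    omega
  have hne : w - w i • u ≠ 0 := fun h =>
    hw (Submodule.mem_span_singleton.2 ⟨w i, (sub_eq_zero.1 h).symm⟩)
  obtain ⟨j, hj⟩ := Function.ne_iff.1 hne
  rw [Pi.zero_apply] at hj
  have hi : (w - w i • u) i = 0 := by simp [hui]
  refine ⟨j, fun h => hj (h ▸ hi), ((w - w i • u) j)⁻¹ • (w - w i • u),
    V.smul_mem _ (V.sub_mem hwV (V.smul_mem _ hu)), ?_, ?_⟩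
  · rw [Pi.smul_apply, hi, smul_zero]
  · rw [Pi.smul_apply, smul_eq_mul, inv_mul_cancel₀ hj]

theorem exists_first_form {V : Submodule ℂ (Fin 4 → ℂ)} (hV : V ≠ ⊥) :
    ∃ i, ∃ u ∈ V, u i = 1 := by
  obtain ⟨u, hu, hne⟩ := Submodule.exists_mem_ne_zero_of_ne_bot hV
  obtain ⟨i, hi⟩ := Function.ne_iff.1 hne
  exact ⟨i, (u i)⁻¹ • u, V.smul_mem _ hu, by rw [Pi.smul_apply, smul_eq_mul, inv_mul_cancel₀ hi]⟩

theorem ne_bot_of_finrank_eq_two {V : Submodule ℂ (Fin 4 → ℂ)} (hV : Module.finrank ℂ V = 2) :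
    V ≠ ⊥ := by
  rintro rfl
  simp at hV

/-- A reduced basis of a two-dimensional space of linear forms. -/
theorem exists_reduced_basis {V : Submodule ℂ (Fin 4 → ℂ)} (hV : Module.finrank ℂ V = 2) :
    ∃ i j, i ≠ j ∧ ∃ u ∈ V, ∃ w ∈ V, u i = 1 ∧ u j = 0 ∧ w i = 0 ∧ w j = 1 := by
  obtain ⟨i, u, hu, hui⟩ := exists_first_form (ne_bot_of_finrank_eq_two hV)
  obtain ⟨j, hj, w, hw, hwi, hwj⟩ := exists_second_form hV hui hu
  exact ⟨i, j, hj.symm, u - u j • w, V.sub_mem hu (V.smul_mem _ hw), w, hw,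
    by simp [hwi, hui], by simp [hwj], hwi, hwj⟩

theorem mem_line_of_perp_eq_span {l : Submodule ℂ (Fin 4 → ℂ)} {u w : Fin 4 → ℂ}
    (h : perp l = Submodule.span ℂ {u, w}) (v : Fin 4 → ℂ) (hu : u ⬝ᵥ v = 0) (hw : w ⬝ᵥ v = 0) :
    v ∈ l := by
  rw [← perp_perp l, mem_perp, h]
  intro x hx
  obtain ⟨a, b, rfl⟩ := Submodule.mem_span_pair.1 hx
  rw [add_dotProduct, smul_dotProduct, smul_dotProduct, hu, hw, smul_zero, smul_zero, add_zero]

theorem isUnit_det_of_rows {A : Matrix (Fin 4) (Fin 4) ℂ}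
    (h : ∀ a b c e : ℂ, a • A 0 + b • A 1 + c • A 2 + e • A 3 = 0 → a = 0 ∧ b = 0 ∧ c = 0 ∧ e = 0) :
    IsUnit A.det := by
  rw [← Matrix.isUnit_iff_isUnit_det, ← Matrix.linearIndependent_rows_iff_isUnit,
    Fintype.linearIndependent_iff]
  intro g hg
  rw [Fin.sum_univ_four] at hg
  obtain ⟨h0, h1, h2, h3⟩ := h _ _ _ _ hg
  intro i
  fin_cases i <;> assumption

theorem isUnit_det_of_disjoint {V₁ V₂ : Submodule ℂ (Fin 4 → ℂ)} (h : V₁ ⊓ V₂ = ⊥)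
    {u₁ w₁ u₂ w₂ : Fin 4 → ℂ} (hu₁ : u₁ ∈ V₁) (hw₁ : w₁ ∈ V₁) (hu₂ : u₂ ∈ V₂) (hw₂ : w₂ ∈ V₂)
    {i₁ j₁ i₂ j₂ : Fin 4} (hui₁ : u₁ i₁ = 1) (hwi₁ : w₁ i₁ = 0) (hwj₁ : w₁ j₁ = 1)
    (hui₂ : u₂ i₂ = 1) (hwi₂ : w₂ i₂ = 0) (hwj₂ : w₂ j₂ = 1) :
    IsUnit (Matrix.of ![u₁, w₁, u₂, w₂]).det := by
  refine isUnit_det_of_rows fun a b c e h0 => ?_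
  change a • u₁ + b • w₁ + c • u₂ + e • w₂ = 0 at h0
  have h1 : a • u₁ + b • w₁ = -(c • u₂ + e • w₂) := by
    rw [eq_neg_iff_add_eq_zero, ← add_assoc, h0]
  have h2 : a • u₁ + b • w₁ = 0 := by
    have : a • u₁ + b • w₁ ∈ V₁ ⊓ V₂ := ⟨V₁.add_mem (V₁.smul_mem _ hu₁) (V₁.smul_mem _ hw₁),
      h1 ▸ V₂.neg_mem (V₂.add_mem (V₂.smul_mem _ hu₂) (V₂.smul_mem _ hw₂))⟩
    rwa [h, Submodule.mem_bot] at this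
  have h3 : c • u₂ + e • w₂ = 0 := by
    rw [h2] at h1
    exact neg_eq_zero.1 h1.symm
  obtain ⟨ha, hb⟩ := pair_eq_zero hui₁ hwi₁ hwj₁ h2
  obtain ⟨hc, he⟩ := pair_eq_zero hui₂ hwi₂ hwj₂ h3
  exact ⟨ha, hb, hc, he⟩

/-- Linear forms adapted to a line. -/
theorem exists_matrix_of_isLine {l : Submodule ℂ (Fin 4 → ℂ)} (hl : IsLine l) :
    ∃ A : Matrix (Fin 4) (Fin 4) ℂ, IsUnit A.det ∧ ∀ v, A 0 ⬝ᵥ v = 0 → A 1 ⬝ᵥ v = 0 → v ∈ l := by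
  have hV : Module.finrank ℂ (perp l) = 2 := by rw [finrank_perp, hl]
  obtain ⟨V, hcompl⟩ := Submodule.exists_isCompl (perp l)
  have hV' : Module.finrank ℂ V = 2 := by
    have := Submodule.finrank_add_eq_of_isCompl hcompl
    rw [hV, Module.finrank_fin_fun] at this
    omega
  obtain ⟨i, j, -, u, hu, w, hw, hui, -, hwi, hwj⟩ := exists_reduced_basis hV
  obtain ⟨i', j', -, u', hu', w', hw', hui', -, hwi', hwj'⟩ := exists_reduced_basis hV'
  exact ⟨_, isUnit_det_of_disjoint hcompl.inf_eq_bot hu hw hu' hw' hui hwi hwj hui' hwi' hwj',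
    mem_line_of_perp_eq_span (eq_span_pair hV hu hw hui hwi hwj)⟩

/-- Linear forms adapted to two meeting lines. -/
theorem exists_forms_of_meet {V₁ V₂ : Submodule ℂ (Fin 4 → ℂ)} (h₁ : Module.finrank ℂ V₁ = 2)
    (h₂ : Module.finrank ℂ V₂ = 2) (hne : V₁ ≠ V₂) (hmeet : V₁ ⊓ V₂ ≠ ⊥) :
    ∃ i j₁ j₂ t : Fin 4, j₁ ≠ i ∧ j₂ ≠ i ∧ ∃ u w₁ w₂ : Fin 4 → ℂ, u i = 1 ∧ w₁ i = 0 ∧ w₁ j₁ = 1 ∧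
      w₂ i = 0 ∧ w₂ j₂ = 1 ∧ V₁ = Submodule.span ℂ {u, w₁} ∧ V₂ = Submodule.span ℂ {u, w₂} ∧
      IsUnit (Matrix.of ![u, w₁, w₂, Pi.single t 1]).det := by
  obtain ⟨i, u, ⟨hu₁, hu₂⟩, hui⟩ := exists_first_form hmeet
  obtain ⟨j₁, hj₁, w₁, hw₁, hwi₁, hwj₁⟩ := exists_second_form h₁ hui hu₁
  obtain ⟨j₂, hj₂, w₂, hw₂, hwi₂, hwj₂⟩ := exists_second_form h₂ hui hu₂
  have hs₁ := eq_span_pair h₁ hu₁ hw₁ hui hwi₁ hwj₁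
  have hs₂ := eq_span_pair h₂ hu₂ hw₂ hui hwi₂ hwj₂
  -- The fourth form is taken among the coordinate forms: a finite choice, which costs no parameter.
  obtain ⟨t, ht⟩ : ∃ t : Fin 4, (Pi.single t 1 : Fin 4 → ℂ) ∉ Submodule.span ℂ {u, w₁, w₂} := by
    by_contra! hc
    have htop : Submodule.span ℂ {u, w₁, w₂} = ⊤ := by
      rw [eq_top_iff, ← (Pi.basisFun ℂ (Fin 4)).span_eq, Submodule.span_le]
      rintro _ ⟨t, rfl⟩
      rw [Pi.basisFun_apply]
      exact hc t
    classical
    have h3 := finrank_span_finset_le_card (R := ℂ) ({u, w₁, w₂} : Finset (Fin 4 → ℂ))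
    rw [Finset.coe_insert, Finset.coe_pair] at h3
    have h4 : ({u, w₁, w₂} : Finset (Fin 4 → ℂ)).card ≤ 3 := Finset.card_le_three
    have h5 : Module.finrank ℂ (Submodule.span ℂ {u, w₁, w₂}) = 4 := by
      rw [htop, finrank_top, Module.finrank_fin_fun]
    have h6 : Set.finrank ℂ {u, w₁, w₂} = 4 := h5
    omega
  refine ⟨i, j₁, j₂, t, hj₁, hj₂, u, w₁, w₂, hui, hwi₁, hwj₁, hwi₂, hwj₂, hs₁, hs₂,
    isUnit_det_of_rows fun a b c e h0 => ?_⟩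
  change a • u + b • w₁ + c • w₂ + e • Pi.single t 1 = 0 at h0
  have he : e = 0 := by
    by_contra he
    apply ht
    have : (Pi.single t 1 : Fin 4 → ℂ) = (-e⁻¹) • (a • u + b • w₁ + c • w₂) := by
      rw [eq_neg_of_add_eq_zero_left h0, smul_neg, neg_smul, neg_neg, smul_smul,
        inv_mul_cancel₀ he, one_smul]
    rw [this]
    have hm {x} (hx : x ∈ ({u, w₁, w₂} : Set (Fin 4 → ℂ))) := Submodule.subset_span (R := ℂ) hx
    exact Submodule.smul_mem _ _ (Submodule.add_mem _ (Submodule.add_mem _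
      (Submodule.smul_mem _ _ (hm (by simp))) (Submodule.smul_mem _ _ (hm (by simp))))
      (Submodule.smul_mem _ _ (hm (by simp))))
  rw [he, zero_smul, add_zero] at h0
  have hc : c = 0 := by
    by_contra hc
    have hw : w₂ ∈ V₁ := by
      have : w₂ = (-c⁻¹) • (a • u + b • w₁) := by
        rw [eq_neg_of_add_eq_zero_left h0, smul_neg, neg_smul, neg_neg, smul_smul,
          inv_mul_cancel₀ hc, one_smul]
      rw [this]
      exact V₁.smul_mem _ (V₁.add_mem (V₁.smul_mem _ hu₁) (V₁.smul_mem _ hw₁))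
    refine hne (Submodule.eq_of_le_of_finrank_eq ?_ (h₂.trans h₁.symm) : V₂ = V₁).symm
    rw [hs₂, Submodule.span_le]
    rintro x (rfl | rfl)
    exacts [hu₁, hw]
  rw [hc, zero_smul, add_zero] at h0
  obtain ⟨ha, hb⟩ := pair_eq_zero hui hwi₁ hwj₁ h0
  exact ⟨ha, hb, hc, he⟩

/-! ### Covers by families, normalized linear forms and monomial counts. -/

/-- A finite cover by families with at most `n` affine parameters. -/
def CoveredByFamilies (A : Set (Surface d)) (n : ℕ) : Prop :=
  ∃ (J : Type) (_ : Finite J) (σ : J → Type) (_ : ∀ j, Finite (σ j))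
    (ψ : ∀ j, Exponent d → MvPolynomial (σ j) ℂ),
    (∀ j, Nat.card (σ j) ≤ n) ∧ (∀ j, ScaleStable (ψ j)) ∧ ∀ S ∈ A, ∃ j, S ∈ paramSet (ψ j)

theorem CoveredByFamilies.krullDim_lt {A : Set (Surface d)} {n : ℕ} (h : CoveredByFamilies A n) :
    topologicalKrullDim (closure A) < n := by
  obtain ⟨J, _, σ, _, ψ, hn, hψ, hA⟩ := h
  exact topologicalKrullDim_closure_lt ψ n hn hψ hA

theorem CoveredByFamilies.union {A B : Set (Surface d)} {n : ℕ} (hA : CoveredByFamilies A n)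
    (hB : CoveredByFamilies B n) : CoveredByFamilies (A ∪ B) n := by
  obtain ⟨J, _, σ, hσ, ψ, hn, hψ, hA⟩ := hA
  obtain ⟨J', _, σ', hσ', ψ', hn', hψ', hB⟩ := hB
  refine ⟨J ⊕ J', inferInstance, Sum.elim σ σ', fun j => ?_,
    fun j => Sum.casesOn j ψ ψ', fun j => ?_, fun j => ?_, fun S hS => ?_⟩
  · cases j <;> simp only [Sum.elim_inl, Sum.elim_inr] <;> infer_instance
  · cases j
    exacts [hn _, hn' _]
  · cases j
    exacts [hψ _, hψ' _]
  · rcases hS with hS | hS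
    · obtain ⟨j, hj⟩ := hA S hS
      exact ⟨Sum.inl j, hj⟩
    · obtain ⟨j, hj⟩ := hB S hS
      exact ⟨Sum.inr j, hj⟩

theorem coveredByFamilies_empty (n : ℕ) : CoveredByFamilies (∅ : Set (Surface d)) n :=
  ⟨Empty, inferInstance, fun _ => Empty, fun _ => inferInstance, fun j => j.elim, fun j => j.elim,
    fun j => j.elim, fun _ hS => hS.elim⟩

theorem CoveredByFamilies.mono {A B : Set (Surface d)} {n : ℕ} (hB : CoveredByFamilies B n)
    (h : A ⊆ B) : CoveredByFamilies A n := by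
  obtain ⟨J, h1, σ, h2, ψ, hn, hψ, hB⟩ := hB
  exact ⟨J, h1, σ, h2, ψ, hn, hψ, fun S hS => hB S (h hS)⟩

/-- A cover by families of polynomials in linear forms depending on parameters. -/
theorem coveredByFamilies_genParam {A : Set (Surface d)} {n : ℕ} {J : Type} [Finite J]
    {τ : J → Type} [∀ j, Finite (τ j)] (B : ∀ j, Matrix (Fin 4) (Fin 4) (MvPolynomial (τ j) ℂ))
    (M : Set (Exponent d)) (hn : ∀ j, Nat.card (τ j) + Nat.card M ≤ n)
    (hA : ∀ S ∈ A, ∃ (j : J) (a : τ j → ℂ) (g : MvPolynomial (Fin 4) ℂ), g.IsHomogeneous d ∧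
      (∀ m : Exponent d, coeff m.1 g ≠ 0 → m ∈ M) ∧
      S.equation = linSub ((B j).map (eval a)) g) : CoveredByFamilies A n := by
  refine ⟨J, inferInstance, fun j => τ j ⊕ M, fun _ => inferInstance, fun j => genParam (B j) M,
    fun j => ?_, fun j => genParam_scaleStable _ _, fun S hS => ?_⟩
  · rw [Nat.card_sum]
    exact hn j
  · obtain ⟨j, a, g, h⟩ := hA S hS
    exact ⟨j, mem_paramSet_genParam.2 ⟨a, g, h⟩⟩

/-- The free coordinates of a linear form with prescribed coordinates `i` and `j`. -/
abbrev FreeCoord (i j : Fin 4) : Type := {s : Fin 4 // s ≠ i ∧ s ≠ j}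

/-- Taking `j = i` encodes a form with a single prescribed coordinate, hence three free ones. -/
theorem card_freeCoord_self (i : Fin 4) : Nat.card (FreeCoord i i) = 3 := by
  rw [Nat.card_eq_fintype_card]
  revert i
  decide

theorem card_freeCoord {i j : Fin 4} (h : i ≠ j) : Nat.card (FreeCoord i j) = 2 := by
  rw [Nat.card_eq_fintype_card]
  revert i j
  decide

/-- A linear form with coordinate `i` equal to one, and coordinate `j` equal to zero unless
`j = i`. -/
def reducedForm {R : Type} [CommRing R] (i j : Fin 4) (f : FreeCoord i j → R) : Fin 4 → R :=
  fun s => if h : s ≠ i ∧ s ≠ j then f ⟨s, h⟩ else if s = i then 1 else 0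

theorem reducedForm_eq {u : Fin 4 → ℂ} {i j : Fin 4} (hi : u i = 1) (hj : i ≠ j → u j = 0) :
    reducedForm i j (fun s => u s.1) = u := by
  funext s
  unfold reducedForm
  split_ifs with h h'
  · rfl
  · rw [h', hi]
  · have hs : s = j := by tauto
    subst hs
    exact (hj (Ne.symm h')).symm

theorem map_reducedForm {R S : Type} [CommRing R] [CommRing S] (φ : R →+* S) (i j : Fin 4)
    (f : FreeCoord i j → R) (s : Fin 4) :
    φ (reducedForm i j f s) = reducedForm i j (fun t => φ (f t)) s := by
  unfold reducedForm
  split_ifs <;> simp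

/-- Monomials of degree at least `k` in the variables `X i` and `X j`. -/
def orderExponents (d k : ℕ) (i j : Fin 4) : Set (Exponent d) := {m | k ≤ m.1 i + m.1 j}

/-- The exponent with given entries. -/
noncomputable def expo (a b c e : ℕ) (h : a + b + c + e = d) : Exponent d :=
  ⟨Finsupp.equivFunOnFinite.symm ![a, b, c, e], by
    rw [Finsupp.degree_eq_sum, Fin.sum_univ_four]
    exact h⟩

@[simp] theorem expo_zero {a b c e : ℕ} (h : a + b + c + e = d) : (expo a b c e h).1 0 = a := rfl
@[simp] theorem expo_one {a b c e : ℕ} (h : a + b + c + e = d) : (expo a b c e h).1 1 = b := rfl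
@[simp] theorem expo_two {a b c e : ℕ} (h : a + b + c + e = d) : (expo a b c e h).1 2 = c := rfl
@[simp] theorem expo_three {a b c e : ℕ} (h : a + b + c + e = d) : (expo a b c e h).1 3 = e := rfl

theorem exponent_sum (m : Exponent d) : m.1 0 + m.1 1 + m.1 2 + m.1 3 = d := by
  have := m.2
  rwa [Finsupp.degree_eq_sum, Fin.sum_univ_four] at this

theorem card_add_le_card {M N : Set (Exponent d)} (hMN : M ⊆ N) (r : ℕ) (f : Fin r → Exponent d)
    (hf : Function.Injective f) (hfN : ∀ i, f i ∈ N) (hfM : ∀ i, f i ∉ M) :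
    Nat.card M + r ≤ Nat.card N := by
  have := Nat.card_le_card_of_injective
    (Sum.elim (fun m : M => (⟨m.1, hMN m.2⟩ : N)) fun i : Fin r => ⟨f i, hfN i⟩) (by
      refine Function.Injective.sumElim (fun m n h => ?_) (fun i j h => ?_) fun m i h => ?_
      · exact Subtype.ext (congrArg (fun x : N => x.1) h)
      · exact hf (congrArg (fun x : N => x.1) h)
      · have : m.1 = f i := congrArg (fun x : N => x.1) h
        exact hfM i (this ▸ m.2))
  rwa [Nat.card_sum, Nat.card_fin] at this

/-- The five monomials `X 0 ^ (d - i) * X 1 ^ i` with `i ≤ 4` have degree zero in the last two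
variables. -/
theorem card_disjoint {k : ℕ} (hk : 1 ≤ k) (hkd : k ≤ d) (hd : 4 ≤ d) :
    Nat.card ↑(orderExponents d k 0 1 ∩ orderExponents d k 2 3) + 5 ≤
      Nat.card (orderExponents d k 0 1) := by
  refine card_add_le_card Set.inter_subset_left 5
    (fun i => expo (d - i) i 0 0 (by omega)) (fun i j h => ?_) (fun i => ?_) fun i h => ?_
  · have := congrArg (fun m : Exponent d => m.1 1) h
    exact Fin.ext this
  · change k ≤ d - i + i
    omega
  · have : k ≤ 0 + 0 := h.2
    omega

/-- For `k = 1` the lost monomials are `X 1 ^ (d - i) * X 3 ^ i` with `i ≤ 3`, where `d ≥ 4`. For `k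
≥ 2` they are `X 1 ^ (d - 1)` times any variable: the degree in `X 0` and `X 2` is at most one, and
the degree in `X 0` and `X 1` is at least `d - 1 ≥ k`. -/
theorem card_meet {k : ℕ} (hk : 1 ≤ k) (hkd : k ≤ d) (h : 4 ≤ d ∨ 2 ≤ k) (hne : k ≠ d) :
    Nat.card ↑(orderExponents d k 0 1 ∩ orderExponents d k 0 2) + 4 ≤
      Nat.card (orderExponents d k 0 1) := by
  by_cases hk1 : k = 1
  · subst hk1
    refine card_add_le_card Set.inter_subset_left 4
      (fun i => expo 0 (d - i) 0 i (by omega)) (fun i j h => ?_) (fun i => ?_) fun i h => ?_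
    · have := congrArg (fun m : Exponent d => m.1 3) h
      exact Fin.ext this
    · change 1 ≤ 0 + (d - i)
      omega
    · have : 1 ≤ 0 + 0 := h.2
      omega
  · refine card_add_le_card Set.inter_subset_left 4
      ![expo 0 d 0 0 (by omega), expo 0 (d - 1) 0 1 (by omega), expo 0 (d - 1) 1 0 (by omega),
        expo 1 (d - 1) 0 0 (by omega)] (fun i j h => ?_) (fun i => ?_) fun i h => ?_
    · have h0 := congrArg (fun m : Exponent d => m.1 0) h
      have h2 := congrArg (fun m : Exponent d => m.1 2) h
      have h3 := congrArg (fun m : Exponent d => m.1 3) h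
      fin_cases i <;> fin_cases j <;> simp at h0 h2 h3 ⊢
    · fin_cases i <;> simp [orderExponents] <;> omega
    · have h2 := h.2
      fin_cases i <;> simp [orderExponents] at h2 <;> omega

/-- `X 1 ^ d` is always lost, which suffices when `k = d`. -/
theorem card_pencil {k : ℕ} (hk : 1 ≤ k) (hkd : k ≤ d) :
    Nat.card ↑(orderExponents d k 0 1 ∩ orderExponents d k 0 2) + 1 ≤
      Nat.card (orderExponents d k 0 1) := by
  refine card_add_le_card Set.inter_subset_left 1
    (fun _ => expo 0 d 0 0 (by omega)) (fun i j _ => Subsingleton.elim i j) (fun i => ?_)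
    fun i h => ?_
  · change k ≤ 0 + d
    omega
  · have : k ≤ 0 + 0 := h.2
    omega

theorem map_of_rows {R S : Type} [CommRing R] [CommRing S] (φ : R →+* S)
    {r₀ r₁ r₂ r₃ : Fin 4 → R} {s₀ s₁ s₂ s₃ : Fin 4 → S} (h₀ : ∀ t, φ (r₀ t) = s₀ t)
    (h₁ : ∀ t, φ (r₁ t) = s₁ t) (h₂ : ∀ t, φ (r₂ t) = s₂ t) (h₃ : ∀ t, φ (r₃ t) = s₃ t) :
    (Matrix.of ![r₀, r₁, r₂, r₃]).map φ = Matrix.of ![s₀, s₁, s₂, s₃] := by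
  ext r t
  fin_cases r
  exacts [h₀ t, h₁ t, h₂ t, h₃ t]

theorem eval_reducedForm {τ : Type} {u : Fin 4 → ℂ} {i j : Fin 4} (hi : u i = 1)
    (hj : i ≠ j → u j = 0) (c : FreeCoord i j → τ) (a : τ → ℂ) (ha : ∀ s, a (c s) = u s.1)
    (t : Fin 4) : eval a (reducedForm i j (fun s => X (c s)) t) = u t := by
  rw [map_reducedForm]
  simp only [eval_X, ha]
  exact congrFun (reducedForm_eq hi hj) t

/-- The equation of a surface in linear forms adapted to two lines of multiplicity `k`. -/
theorem exists_equation_eq_linSub {S : Surface d} {k : ℕ} {A : Matrix (Fin 4) (Fin 4) ℂ}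
    (hA : IsUnit A.det) {i₁ j₁ i₂ j₂ : Fin 4} {l₁ l₂ : Submodule ℂ (Fin 4 → ℂ)}
    (hl₁ : perp l₁ = Submodule.span ℂ {A i₁, A j₁}) (hl₂ : perp l₂ = Submodule.span ℂ {A i₂, A j₂})
    (hS₁ : S.ContainsToOrder k l₁) (hS₂ : S.ContainsToOrder k l₂) :
    ∃ g : MvPolynomial (Fin 4) ℂ, g.IsHomogeneous d ∧
      (∀ m : Exponent d, coeff m.1 g ≠ 0 →
        m ∈ orderExponents d k i₁ j₁ ∩ orderExponents d k i₂ j₂) ∧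
      S.equation = linSub A g :=
  ⟨linSub A⁻¹ S.equation, linSub_isHomogeneous _ S.equation_isHomogeneous,
    fun m hm => ⟨linSub_inv_mem_orderIdeal hA (mem_line_of_perp_eq_span hl₁) hS₁ m.1 hm,
      linSub_inv_mem_orderIdeal hA (mem_line_of_perp_eq_span hl₂) hS₂ m.1 hm⟩,
    (linSub_linSub_inv hA _).symm⟩

theorem exists_exponent_mem {S : Surface d} {A : Matrix (Fin 4) (Fin 4) ℂ}
    {g : MvPolynomial (Fin 4) ℂ} (hg : g.IsHomogeneous d) {M : Set (Exponent d)}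
    (hM : ∀ m : Exponent d, coeff m.1 g ≠ 0 → m ∈ M) (hS : S.equation = linSub A g) :
    M.Nonempty := by
  by_contra hne
  apply S.equation_ne_zero
  have h0 : g = 0 := by
    rw [← ofCoords_coeff hg, ofCoords]
    refine Finset.sum_eq_zero fun m _ => ?_
    have : coeff m.1 g = 0 := by
      by_contra h
      exact hne ⟨m, hM m h⟩
    rw [this, monomial_zero]
  rw [hS, h0, map_zero]

/-! ### The parameter count for surfaces with two lines. -/

/-- Surfaces containing two disjoint lines with multiplicity `k`. -/
theorem coveredByFamilies_disjoint {k : ℕ} (hk : 1 ≤ k) (hkd : k ≤ d) (h : 4 ≤ d ∨ 2 ≤ k) :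
    CoveredByFamilies {S : Surface d | ∃ l₁ l₂, IsLine l₁ ∧ IsLine l₂ ∧ perp l₁ ⊓ perp l₂ = ⊥ ∧
      S.ContainsToOrder k l₁ ∧ S.ContainsToOrder k l₂}
      (Nat.card (orderExponents d k 0 1) + 3) := by
  have key {S : Surface d} {l₁ l₂ : Submodule ℂ (Fin 4 → ℂ)} (hl₁ : IsLine l₁) (hl₂ : IsLine l₂)
      (hdisj : perp l₁ ⊓ perp l₂ = ⊥) (hS₁ : S.ContainsToOrder k l₁)
      (hS₂ : S.ContainsToOrder k l₂) :
      ∃ i₁ j₁ i₂ j₂, i₁ ≠ j₁ ∧ i₂ ≠ j₂ ∧ ∃ u₁ w₁ u₂ w₂ : Fin 4 → ℂ,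
        u₁ i₁ = 1 ∧ u₁ j₁ = 0 ∧ w₁ i₁ = 0 ∧ w₁ j₁ = 1 ∧
        u₂ i₂ = 1 ∧ u₂ j₂ = 0 ∧ w₂ i₂ = 0 ∧ w₂ j₂ = 1 ∧
        ∃ g : MvPolynomial (Fin 4) ℂ, g.IsHomogeneous d ∧
          (∀ m : Exponent d, coeff m.1 g ≠ 0 →
            m ∈ orderExponents d k 0 1 ∩ orderExponents d k 2 3) ∧
          S.equation = linSub (Matrix.of ![u₁, w₁, u₂, w₂]) g := by
    have h₁ : Module.finrank ℂ (perp l₁) = 2 := by rw [finrank_perp, hl₁]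
    have h₂ : Module.finrank ℂ (perp l₂) = 2 := by rw [finrank_perp, hl₂]
    obtain ⟨i₁, j₁, hij₁, u₁, hu₁, w₁, hw₁, hui₁, huj₁, hwi₁, hwj₁⟩ := exists_reduced_basis h₁
    obtain ⟨i₂, j₂, hij₂, u₂, hu₂, w₂, hw₂, hui₂, huj₂, hwi₂, hwj₂⟩ := exists_reduced_basis h₂
    have hA := isUnit_det_of_disjoint hdisj hu₁ hw₁ hu₂ hw₂ hui₁ hwi₁ hwj₁ hui₂ hwi₂ hwj₂
    exact ⟨i₁, j₁, i₂, j₂, hij₁, hij₂, u₁, w₁, u₂, w₂, hui₁, huj₁, hwi₁, hwj₁, hui₂, huj₂, hwi₂,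
      hwj₂, exists_equation_eq_linSub hA (i₁ := 0) (j₁ := 1) (i₂ := 2) (j₂ := 3)
        (eq_span_pair h₁ hu₁ hw₁ hui₁ hwi₁ hwj₁) (eq_span_pair h₂ hu₂ hw₂ hui₂ hwi₂ hwj₂) hS₁ hS₂⟩
  -- A monomial of degree at least `k` in each of two disjoint pairs of variables has degree at
  -- least `2 * k`, so otherwise there are no such surfaces.
  by_cases hd : d < 2 * k
  · refine (coveredByFamilies_empty _).mono ?_
    rintro S ⟨l₁, l₂, hl₁, hl₂, hdisj, hS₁, hS₂⟩
    obtain ⟨i₁, j₁, i₂, j₂, -, -, u₁, w₁, u₂, w₂, -, -, -, -, -, -, -, -, g, hg, hM, hS⟩ :=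
      key hl₁ hl₂ hdisj hS₁ hS₂
    obtain ⟨m, hm₁, hm₂⟩ := exists_exponent_mem hg hM hS
    have h1 : k ≤ m.1 0 + m.1 1 := hm₁
    have h2 : k ≤ m.1 2 + m.1 3 := hm₂
    have := exponent_sum m
    omega
  refine coveredByFamilies_genParam
    (J := {p : Fin 4 × Fin 4 // p.1 ≠ p.2} × {p : Fin 4 × Fin 4 // p.1 ≠ p.2})
    (τ := fun p => (FreeCoord p.1.1.1 p.1.1.2 ⊕ FreeCoord p.1.1.2 p.1.1.1) ⊕
      (FreeCoord p.2.1.1 p.2.1.2 ⊕ FreeCoord p.2.1.2 p.2.1.1))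
    (fun p => Matrix.of ![reducedForm p.1.1.1 p.1.1.2 fun s => X (Sum.inl (Sum.inl s)),
      reducedForm p.1.1.2 p.1.1.1 fun s => X (Sum.inl (Sum.inr s)),
      reducedForm p.2.1.1 p.2.1.2 fun s => X (Sum.inr (Sum.inl s)),
      reducedForm p.2.1.2 p.2.1.1 fun s => X (Sum.inr (Sum.inr s))])
    (orderExponents d k 0 1 ∩ orderExponents d k 2 3) ?_ ?_
  · rintro ⟨p, q⟩
    rw [Nat.card_sum, Nat.card_sum, Nat.card_sum, card_freeCoord p.2, card_freeCoord p.2.symm,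
      card_freeCoord q.2, card_freeCoord q.2.symm]
    -- Four reduced forms have two free coordinates each: `8 - 5 = 3`. The bound `4 ≤ d` follows
    -- from `2 * k ≤ d` when `k ≥ 2`.
    have := card_disjoint hk hkd (by omega)
    omega
  · rintro S ⟨l₁, l₂, hl₁, hl₂, hdisj, hS₁, hS₂⟩
    obtain ⟨i₁, j₁, i₂, j₂, hij₁, hij₂, u₁, w₁, u₂, w₂, hui₁, huj₁, hwi₁, hwj₁, hui₂, huj₂, hwi₂,
      hwj₂, g, hg, hM, hS⟩ := key hl₁ hl₂ hdisj hS₁ hS₂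
    let a := Sum.elim
      (Sum.elim (fun s : FreeCoord i₁ j₁ => u₁ s.1) fun s : FreeCoord j₁ i₁ => w₁ s.1)
      (Sum.elim (fun s : FreeCoord i₂ j₂ => u₂ s.1) fun s : FreeCoord j₂ i₂ => w₂ s.1)
    refine ⟨(⟨(i₁, j₁), hij₁⟩, ⟨(i₂, j₂), hij₂⟩), a, g, hg, hM, ?_⟩
    exact hS.trans (congrArg (fun A => linSub A g) (map_of_rows (eval a)
      (eval_reducedForm hui₁ (fun _ => huj₁) (fun s => Sum.inl (Sum.inl s)) a fun _ => rfl)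
      (eval_reducedForm hwj₁ (fun _ => hwi₁) (fun s => Sum.inl (Sum.inr s)) a fun _ => rfl)
      (eval_reducedForm hui₂ (fun _ => huj₂) (fun s => Sum.inr (Sum.inl s)) a fun _ => rfl)
      (eval_reducedForm hwj₂ (fun _ => hwi₂) (fun s => Sum.inr (Sum.inr s)) a fun _ => rfl)).symm)

/-- Surfaces containing two distinct meeting lines with multiplicity `k`. -/
theorem coveredByFamilies_meet {k : ℕ} (hk : 1 ≤ k) (hkd : k ≤ d) (h : 4 ≤ d ∨ 2 ≤ k) :
    CoveredByFamilies {S : Surface d | ∃ l₁ l₂, IsLine l₁ ∧ IsLine l₂ ∧ l₁ ≠ l₂ ∧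
      perp l₁ ⊓ perp l₂ ≠ ⊥ ∧ S.ContainsToOrder k l₁ ∧ S.ContainsToOrder k l₂}
      (Nat.card (orderExponents d k 0 1) + 3) := by
  have key {S : Surface d} {l₁ l₂ : Submodule ℂ (Fin 4 → ℂ)} (hl₁ : IsLine l₁) (hl₂ : IsLine l₂)
      (hne : l₁ ≠ l₂) (hmeet : perp l₁ ⊓ perp l₂ ≠ ⊥) (hS₁ : S.ContainsToOrder k l₁)
      (hS₂ : S.ContainsToOrder k l₂) :
      ∃ i j₁ j₂ t : Fin 4, j₁ ≠ i ∧ j₂ ≠ i ∧ ∃ u w₁ w₂ : Fin 4 → ℂ,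
        u i = 1 ∧ w₁ i = 0 ∧ w₁ j₁ = 1 ∧ w₂ i = 0 ∧ w₂ j₂ = 1 ∧
        ∃ g : MvPolynomial (Fin 4) ℂ, g.IsHomogeneous d ∧
          (∀ m : Exponent d, coeff m.1 g ≠ 0 →
            m ∈ orderExponents d k 0 1 ∩ orderExponents d k 0 2) ∧
          S.equation = linSub (Matrix.of ![u, w₁, w₂, Pi.single t 1]) g := by
    have hne' : perp l₁ ≠ perp l₂ := fun h => hne (by rw [← perp_perp l₁, h, perp_perp])
    obtain ⟨i, j₁, j₂, t, hj₁, hj₂, u, w₁, w₂, hui, hwi₁, hwj₁, hwi₂, hwj₂, hs₁, hs₂, hA⟩ :=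
      exists_forms_of_meet (by rw [finrank_perp, hl₁]) (by rw [finrank_perp, hl₂]) hne' hmeet
    exact ⟨i, j₁, j₂, t, hj₁, hj₂, u, w₁, w₂, hui, hwi₁, hwj₁, hwi₂, hwj₂,
      exists_equation_eq_linSub hA (i₁ := 0) (j₁ := 1) (i₂ := 0) (j₂ := 2) hs₁ hs₂ hS₁ hS₂⟩
  -- For `k = d` only the monomial `X 0 ^ d` survives, so the other three rows do not matter and can
  -- be zero; the four coefficients of the first form are the only parameters of the matrix.
  by_cases hd : k = d
  · refine coveredByFamilies_genParam (J := Unit) (τ := fun _ => Fin 4)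
      (fun _ => Matrix.of ![X, 0, 0, 0])
      (orderExponents d k 0 1 ∩ orderExponents d k 0 2) ?_ ?_
    · intro _
      rw [Nat.card_fin]
      have := card_pencil hk hkd
      omega
    · rintro S ⟨l₁, l₂, hl₁, hl₂, hne, hmeet, hS₁, hS₂⟩
      obtain ⟨i, j₁, j₂, t, -, -, u, w₁, w₂, -, -, -, -, -, g, hg, hM, hS⟩ :=
        key hl₁ hl₂ hne hmeet hS₁ hS₂
      refine ⟨(), u, g, hg, hM, ?_⟩
      rw [hS, ← ofCoords_coeff hg, ofCoords, map_sum, map_sum]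
      refine Finset.sum_congr rfl fun m _ => ?_
      by_cases hm : coeff m.1 g = 0
      · rw [hm, monomial_zero, map_zero, map_zero]
      obtain ⟨h1, h2⟩ := hM m hm
      have h1' : k ≤ m.1 0 + m.1 1 := h1
      have h2' : k ≤ m.1 0 + m.1 2 := h2
      have hsum := exponent_sum m
      have e1 : m.1 1 = 0 := by omega
      have e2 : m.1 2 = 0 := by omega
      have e3 : m.1 3 = 0 := by omega
      rw [linSub_monomial, linSub_monomial, Fin.prod_univ_four, Fin.prod_univ_four, e1, e2, e3]
      simp only [pow_zero, mul_one]
      congr 3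
      funext s
      exact (eval_X s).symm
  refine coveredByFamilies_genParam
    (J := {p : Fin 4 × Fin 4 × Fin 4 × Fin 4 // p.2.1 ≠ p.1 ∧ p.2.2.1 ≠ p.1})
    (τ := fun p => FreeCoord p.1.1 p.1.1 ⊕ (FreeCoord p.1.2.1 p.1.1 ⊕ FreeCoord p.1.2.2.1 p.1.1))
    (fun p => Matrix.of ![reducedForm p.1.1 p.1.1 fun s => X (Sum.inl s),
      reducedForm p.1.2.1 p.1.1 fun s => X (Sum.inr (Sum.inl s)),
      reducedForm p.1.2.2.1 p.1.1 fun s => X (Sum.inr (Sum.inr s)),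
      Pi.single p.1.2.2.2 1])
    (orderExponents d k 0 1 ∩ orderExponents d k 0 2) ?_ ?_
  · rintro p
    rw [Nat.card_sum, Nat.card_sum, card_freeCoord_self, card_freeCoord p.2.1,
      card_freeCoord p.2.2]
    -- The common form has three free coordinates and the other two have two each: `7 - 4 = 3`.
    have := card_meet hk hkd h hd
    omega
  · rintro S ⟨l₁, l₂, hl₁, hl₂, hne, hmeet, hS₁, hS₂⟩
    obtain ⟨i, j₁, j₂, t, hj₁, hj₂, u, w₁, w₂, hui, hwi₁, hwj₁, hwi₂, hwj₂, g, hg, hM, hS⟩ :=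
      key hl₁ hl₂ hne hmeet hS₁ hS₂
    let a := Sum.elim (fun s : FreeCoord i i => u s.1)
      (Sum.elim (fun s : FreeCoord j₁ i => w₁ s.1) fun s : FreeCoord j₂ i => w₂ s.1)
    refine ⟨⟨(i, j₁, j₂, t), hj₁, hj₂⟩, a, g, hg, hM, ?_⟩
    exact hS.trans (congrArg (fun A => linSub A g) (map_of_rows (eval a)
      (r₃ := Pi.single t 1) (s₃ := Pi.single t 1)
      (eval_reducedForm hui (fun h => absurd rfl h) (fun s => Sum.inl s) a fun _ => rfl)
      (eval_reducedForm hwj₁ (fun _ => hwi₁) (fun s => Sum.inr (Sum.inl s)) a fun _ => rfl)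
      (eval_reducedForm hwj₂ (fun _ => hwi₂) (fun s => Sum.inr (Sum.inr s)) a fun _ => rfl)
      (fun s => by simp only [Pi.single_apply, apply_ite (eval a), map_one, map_zero])).symm)

theorem coveredByFamilies_doubL {k : ℕ} (hk : 1 ≤ k) (hkd : k ≤ d) (h : 4 ≤ d ∨ 2 ≤ k) :
    CoveredByFamilies (DoubL k d) (Nat.card (orderExponents d k 0 1) + 3) := by
  refine ((coveredByFamilies_disjoint hk hkd h).union (coveredByFamilies_meet hk hkd h)).mono ?_
  rintro S ⟨l₁, l₂, hl₁, hl₂, hne, hS₁, hS₂⟩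
  by_cases hdisj : perp l₁ ⊓ perp l₂ = ⊥
  · exact Or.inl ⟨l₁, l₂, hl₁, hl₂, hdisj, hS₁, hS₂⟩
  · exact Or.inr ⟨l₁, l₂, hl₁, hl₂, hne, hdisj, hS₁, hS₂⟩

/-! ### Irreducibility of the locus of surfaces with a `k`-fold line. -/

/-- Degenerate parameter values do no harm: two linear forms, even dependent ones, vanish on some
common line. -/
theorem paramSet_genParam_subset_singL {τ : Type} (A : Matrix (Fin 4) (Fin 4) (MvPolynomial τ ℂ))
    (k : ℕ) : paramSet (genParam A (orderExponents d k 0 1)) ⊆ SingL k d := by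
  intro S hS
  obtain ⟨a, g, hg, hM, hS⟩ := mem_paramSet_genParam.1 hS
  obtain ⟨l, hl, hlA⟩ := exists_isLine (A.map (eval a) 0) (A.map (eval a) 1)
  refine ⟨l, hl, ?_⟩
  rw [Surface.ContainsToOrder, hS]
  refine linSub_mem_vanishingIdeal_pow (i := 0) (j := 1) (by decide) hlA fun m hm => ?_
  have hd : m.degree = d := by
    by_contra h
    rw [Finsupp.degree_eq_weight_one] at h
    exact hm (hg.coeff_eq_zero (by rwa [Finsupp.degree_eq_weight_one]))
  exact hM ⟨m, hd⟩ hm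

/-- The surfaces with a line of multiplicity `k` form one family. -/
theorem singL_eq_paramSet (k : ℕ) : SingL k d = paramSet (genParam
    (Matrix.of fun i j => X (i, j) : Matrix (Fin 4) (Fin 4) (MvPolynomial (Fin 4 × Fin 4) ℂ))
    (orderExponents d k 0 1)) := by
  -- The sixteen matrix entries are redundant parameters; this family serves only to prove
  -- irreducibility.
  refine Set.Subset.antisymm ?_ (paramSet_genParam_subset_singL _ k)
  rintro S ⟨l, hl, hS⟩
  obtain ⟨A, hA, hAl⟩ := exists_matrix_of_isLine hl
  refine mem_paramSet_genParam.2 ⟨fun p => A p.1 p.2, linSub A⁻¹ S.equation,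
    linSub_isHomogeneous _ S.equation_isHomogeneous,
    fun m hm => linSub_inv_mem_orderIdeal hA hAl hS m.1 hm, ?_⟩
  have : (Matrix.of fun i j => X (i, j) : Matrix (Fin 4) (Fin 4)
      (MvPolynomial (Fin 4 × Fin 4) ℂ)).map (eval fun p => A p.1 p.2) = A := by
    ext i j
    exact eval_X _
  rw [this, linSub_linSub_inv hA]

theorem isPreirreducible_singL (k : ℕ) : IsPreirreducible (SingL k d) := by
  rw [singL_eq_paramSet]
  exact isPreirreducible_paramSet (genParam_scaleStable _ _)

/-! ### Restriction of families to coordinate subspaces of parameters. -/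

section Restriction

variable {ι : Type}

open Classical in
/-- Extension of a vector by zero. -/
noncomputable def extendZero {R : Type} [Zero R] (B : Set ι) (q : B → R) : ι → R :=
  fun s => if h : s ∈ B then q ⟨s, h⟩ else 0

theorem extendZero_of_mem {R : Type} [Zero R] {B : Set ι} (q : B → R) {s : ι} (h : s ∈ B) :
    extendZero B q s = q ⟨s, h⟩ := dif_pos h

theorem extendZero_of_notMem {R : Type} [Zero R] {B : Set ι} (q : B → R) {s : ι} (h : s ∉ B) :
    extendZero B q s = 0 := dif_neg h

/-- Restriction of a polynomial to a coordinate subspace. -/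
noncomputable def restrictVars (B : Set ι) : MvPolynomial ι ℂ →ₐ[ℂ] MvPolynomial B ℂ :=
  aeval (extendZero B X)

theorem aeval_restrictVars {R : Type} [CommRing R] [Algebra ℂ R] (B : Set ι) (q : B → R)
    (F : MvPolynomial ι ℂ) : aeval q (restrictVars B F) = aeval (extendZero B q) F := by
  rw [restrictVars, ← AlgHom.comp_apply, comp_aeval]
  congr 2
  funext s
  by_cases h : s ∈ B
  · rw [extendZero_of_mem _ h, extendZero_of_mem _ h, aeval_X]
  · rw [extendZero_of_notMem _ h, extendZero_of_notMem _ h, map_zero]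

theorem eval_restrictVars (B : Set ι) (q : B → ℂ) (F : MvPolynomial ι ℂ) :
    eval q (restrictVars B F) = eval (extendZero B q) F := by
  have := aeval_restrictVars B q F
  simpa only [aeval_eq_eval] using this

theorem paramSet_restrictVars_subset (ψ : Exponent d → MvPolynomial ι ℂ) (B : Set ι) :
    paramSet (fun n => restrictVars B (ψ n)) ⊆ paramSet ψ := by
  rintro S ⟨v, hv⟩
  exact ⟨extendZero B v, fun m => by rw [hv, eval_restrictVars]⟩

theorem paramSet_restrictVars_mono (ψ : Exponent d → MvPolynomial ι ℂ) {B B' : Set ι}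
    (h : B ⊆ B') : paramSet (fun n => restrictVars B (ψ n)) ⊆
      paramSet (fun n => restrictVars B' (ψ n)) := by
  rintro S ⟨v, hv⟩
  refine ⟨fun s => extendZero B v s.1, fun m => ?_⟩
  rw [hv, eval_restrictVars, eval_restrictVars]
  congr 2
  funext s
  by_cases hs : s ∈ B'
  · rw [extendZero_of_mem _ hs]
  · rw [extendZero_of_notMem _ hs, extendZero_of_notMem _ fun hb => hs (h hb)]

/-- The family is linear in its coefficients; scaling these and keeping the matrix parameters
preserves each coordinate subspace. -/
theorem restrictVars_genParam_scaleStable {τ : Type}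
    (A : Matrix (Fin 4) (Fin 4) (MvPolynomial τ ℂ)) (M : Set (Exponent d)) (B : Set (τ ⊕ M)) :
    ScaleStable fun n => restrictVars B (genParam A M n) := by
  intro v t
  refine ⟨fun s => Sum.elim (fun _ => v s) (fun _ => t * v s) s.1, fun n => ?_⟩
  rw [eval_restrictVars, eval_restrictVars, ← eval_genParam_scale]
  congr 2
  funext s
  by_cases h : s ∈ B
  · rw [extendZero_of_mem _ h]
    cases s <;> simp [extendZero_of_mem _ h]
  · rw [extendZero_of_notMem _ h]
    cases s <;> simp [extendZero_of_notMem _ h]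

end Restriction

/-! ### The Jacobian of the chart and the lower bound. -/

section Jacobian

/-- Linear forms adapted to a line close to the line `X 0 = X 1 = 0`. -/
def chartMatrix {R : Type} [CommRing R] (v : Fin 4 → R) : Matrix (Fin 4) (Fin 4) R :=
  !![1, 0, v 0, v 1; 0, 1, v 2, v 3; 0, 0, 1, 0; 0, 0, 0, 1]

theorem chartMatrix_zero {R : Type} [CommRing R] : chartMatrix (0 : Fin 4 → R) = 1 := by
  ext i j
  fin_cases i <;> fin_cases j <;> simp [chartMatrix]

theorem map_chartMatrix {R S : Type} [CommRing R] [CommRing S] (φ : R →+* S) (v : Fin 4 → R) :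
    (chartMatrix v).map φ = chartMatrix fun t => φ (v t) := by
  ext i j
  fin_cases i <;> fin_cases j <;> simp [chartMatrix]

/-- The monomials that appear when the line `X 0 = X 1 = 0` is moved. -/
noncomputable def tangentExponent {k : ℕ} (hk : 1 ≤ k) (hkd : k ≤ d) : Fin 4 → Exponent d :=
  ![expo (k - 1) 0 (d - k + 1) 0 (by omega), expo (k - 1) 0 (d - k) 1 (by omega),
    expo 0 (k - 1) 1 (d - k) (by omega), expo 0 (k - 1) 0 (d - k + 1) (by omega)]

/-- For `k ≥ 2` the first two exponents involve `X 0` and the last two do not; for `k = 1` the four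
differ as soon as `d ≥ 3`. -/
theorem tangentExponent_injective {k : ℕ} (hk : 1 ≤ k) (hkd : k ≤ d) (h : 4 ≤ d ∨ 2 ≤ k) :
    Function.Injective (tangentExponent hk hkd) := by
  intro i j hij
  have h0 := congrArg (fun m : Exponent d => m.1 0) hij
  have h2 := congrArg (fun m : Exponent d => m.1 2) hij
  have h3 := congrArg (fun m : Exponent d => m.1 3) hij
  fin_cases i <;> fin_cases j <;> simp [tangentExponent] at h0 h2 h3 ⊢ <;> omega

theorem tangentExponent_notMem {k : ℕ} (hk : 1 ≤ k) (hkd : k ≤ d) (t : Fin 4) :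
    tangentExponent hk hkd t ∉ orderExponents d k 0 1 := by
  fin_cases t <;> simp [tangentExponent, orderExponents] <;> omega

theorem monomial_expo {R : Type} [CommRing R] {a b c e : ℕ} (h : a + b + c + e = d) (r : R) :
    monomial (expo a b c e h).1 r = C r * (X 0 ^ a * X 1 ^ b * X 2 ^ c * X 3 ^ e) := by
  rw [monomial_eq, Finsupp.prod_fintype _ _ (by simp), Fin.prod_univ_four]
  rfl

theorem add_pow_of_sq_eq_zero {R : Type} [CommRing R] (x y : R) (hy : y ^ 2 = 0) (n : ℕ) :
    (x + y) ^ n = x ^ n + n * x ^ (n - 1) * y := by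
  have := Polynomial.aeval_add_of_sq_eq_zero (Polynomial.X ^ n : Polynomial R) x y hy
  simpa [Polynomial.derivative_X_pow] using this

/-- The exponent of `X 0 ^ k * X 2 ^ (d - k)`. -/
noncomputable def firstExponent {k : ℕ} (hkd : k ≤ d) : Exponent d :=
  expo k 0 (d - k) 0 (by omega)

/-- The exponent of `X 1 ^ k * X 3 ^ (d - k)`. -/
noncomputable def secondExponent {k : ℕ} (hkd : k ≤ d) : Exponent d :=
  expo 0 k 0 (d - k) (by omega)

/-- First-order Taylor expansion: all products of entries of `v` vanish. Moving either form defining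
the line produces two monomials, whence the two summands of the base polynomial. -/
theorem linSub_chartMatrix {R : Type} [CommRing R] (v : Fin 4 → R) (hv : ∀ s t, v s * v t = 0)
    {k : ℕ} (hk : 1 ≤ k) (hkd : k ≤ d) :
    linSub (chartMatrix v) (monomial (firstExponent hkd).1 1 + monomial (secondExponent hkd).1 1) =
      monomial (firstExponent hkd).1 1 + monomial (secondExponent hkd).1 1 +
        ∑ t, C (v t) * monomial (tangentExponent hk hkd t).1 (k : R) := by
  have h0 : linForm (chartMatrix v 0) = X 0 + (C (v 0) * X 2 + C (v 1) * X 3) := by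
    simp [linForm, chartMatrix, Fin.sum_univ_four, add_assoc]
  have h1 : linForm (chartMatrix v 1) = X 1 + (C (v 2) * X 2 + C (v 3) * X 3) := by
    simp [linForm, chartMatrix, Fin.sum_univ_four, add_assoc]
  have h2 : linForm (chartMatrix v 2) = X 2 := by
    simp [linForm, chartMatrix, Fin.sum_univ_four]
  have h3 : linForm (chartMatrix v 3) = X 3 := by
    simp [linForm, chartMatrix, Fin.sum_univ_four]
  have hsq (s t : Fin 4) : (C (v s) * X 2 + C (v t) * X 3 : MvPolynomial (Fin 4) R) ^ 2 = 0 := by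
    have hC (s t : Fin 4) : (C (v s) * C (v t) : MvPolynomial (Fin 4) R) = 0 := by
      rw [← C_mul, hv, C_0]
    linear_combination X 2 ^ 2 * hC s s + 2 * X 2 * X 3 * hC s t + X 3 ^ 2 * hC t t
  rw [map_add, linSub_monomial, linSub_monomial, Fin.prod_univ_four, Fin.prod_univ_four, h0, h1,
    h2, h3]
  simp only [firstExponent, secondExponent, expo_zero, expo_one, expo_two, expo_three,
    add_pow_of_sq_eq_zero _ _ (hsq _ _)]
  rw [Fin.sum_univ_four]
  simp only [tangentExponent, Matrix.cons_val, monomial_expo, pow_succ, map_natCast]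
  simp only [C_1, pow_zero]
  ring

theorem coeff_sum_monomial {R : Type} [CommRing R] {M : Set (Exponent d)} (x : M → R)
    {n : Exponent d} (hn : n ∈ M) : coeff n.1 (∑ m : M, monomial m.1.1 (x m)) = x ⟨n, hn⟩ := by
  classical
  rw [coeff_sum, Finset.sum_eq_single ⟨n, hn⟩]
  · rw [coeff_monomial, if_pos rfl]
  · intro m _ hm
    rw [coeff_monomial, if_neg]
    exact fun h => hm (Subtype.ext (Subtype.ext h))
  · simp

theorem coeff_sum_monomial_of_notMem {R : Type} [CommRing R] {M : Set (Exponent d)} (x : M → R)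
    {n : Exponent d} (hn : n ∉ M) : coeff n.1 (∑ m : M, monomial m.1.1 (x m)) = 0 := by
  classical
  rw [coeff_sum]
  refine Finset.sum_eq_zero fun m _ => ?_
  rw [coeff_monomial, if_neg]
  exact fun h => hn (Subtype.ext h ▸ m.2)

/-- The base point is the unmoved line with the polynomial of `linSub_chartMatrix`. Coefficient
parameters are matched with their own monomials and line parameters with tangent monomials, which
lie outside the family at the base point, so the Jacobian is diagonal with entries `1` and `k`. By
`hB`, the base polynomial is available whenever a line parameter is. -/
theorem jacobian_genParam {k : ℕ} (hk : 1 ≤ k) (hkd : k ≤ d) (h : 4 ≤ d ∨ 2 ≤ k)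
    (B : Set (Fin 4 ⊕ orderExponents d k 0 1))
    (hB : ∀ t, Sum.inl t ∈ B → ∀ m, Sum.inr m ∈ B) :
    ∃ c : B → Exponent d, ∀ F : MvPolynomial B ℂ, aeval (fun s => restrictVars B
      (genParam (chartMatrix X) (orderExponents d k 0 1) (c s))) F = 0 → F = 0 := by
  classical
  have : Fintype B := Fintype.ofFinite B
  let e₁ : Exponent d := firstExponent hkd
  let e₂ : Exponent d := secondExponent hkd
  have he₁ : e₁ ∈ orderExponents d k 0 1 := by
    change k ≤ k + 0
    omega
  have he₂ : e₂ ∈ orderExponents d k 0 1 := by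
    change k ≤ 0 + k
    omega
  have he : e₁ ≠ e₂ := fun h => by
    have : k = 0 := congrArg (fun m : Exponent d => m.1 0) h
    omega
  let c' : Fin 4 ⊕ orderExponents d k 0 1 → Exponent d :=
    Sum.elim (tangentExponent hk hkd) fun m => m.1
  have hc' : Function.Injective c' := by
    refine Function.Injective.sumElim (tangentExponent_injective hk hkd h)
      Subtype.val_injective fun t m ht => ?_
    exact tangentExponent_notMem hk hkd t (ht ▸ m.2)
  let p : Fin 4 ⊕ orderExponents d k 0 1 → ℂ :=
    Sum.elim 0 fun m => (if m.1 = e₁ then 1 else 0) + (if m.1 = e₂ then 1 else 0)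
  refine ⟨fun s => c' s.1, eq_zero_of_aeval_eq_zero_of_jacobian _ (fun s => p s.1)
    (fun s => Sum.elim (fun _ => (k : ℂ)) (fun _ => 1) s.1) ?_ ?_⟩
  · rintro ⟨s | s, hs⟩
    · exact Nat.cast_ne_zero.2 (by omega)
    · exact one_ne_zero
  · intro i j
    -- The base point moved infinitesimally in direction `j`: the infinitesimal part of a value
    -- there is the partial derivative.
    let q : B → DualNumber ℂ := fun s =>
      TrivSqZeroExt.inl (p s.1) + TrivSqZeroExt.inr (if s = j then 1 else 0)
    have hq := (aeval_dualNumber (restrictVars B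
      (genParam (chartMatrix X) (orderExponents d k 0 1) (c' i.1))) q).2
    have hfst : (fun s => (q s).fst) = fun s => p s.1 := by
      funext s
      simp only [q, TrivSqZeroExt.fst_add, TrivSqZeroExt.fst_inl, TrivSqZeroExt.fst_inr, add_zero]
    have hsnd (s) : (q s).snd = if s = j then 1 else 0 := by
      simp only [q, TrivSqZeroExt.snd_add, TrivSqZeroExt.snd_inl, TrivSqZeroExt.snd_inr, zero_add]
    rw [hfst, aeval_restrictVars, aeval_genParam] at hq
    simp only [hsnd, ite_mul, one_mul, zero_mul, Finset.sum_ite_eq', Finset.mem_univ, if_true] at hq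
    rw [← hq]
    have hchart (f : Fin 4 → DualNumber ℂ) :
        (chartMatrix (X : Fin 4 → MvPolynomial (Fin 4) ℂ)).map (aeval f) = chartMatrix f := by
      refine (map_chartMatrix (aeval f : MvPolynomial (Fin 4) ℂ →ₐ[ℂ] DualNumber ℂ).toRingHom
        X).trans ?_
      congr 1
      funext t
      exact aeval_X f t
    rw [hchart]
    have hi : extendZero B q i.1 = q i := extendZero_of_mem q i.2
    obtain ⟨j | j, hj⟩ := j
    · have hinr (m) : extendZero B q (Sum.inr m) = TrivSqZeroExt.inl (p (Sum.inr m)) := by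
        rw [extendZero_of_mem _ (hB j hj m)]
        simp [q]
      have hinl (t) : extendZero B q (Sum.inl t) =
          if t = j then (TrivSqZeroExt.inr 1 : DualNumber ℂ) else 0 := by
        by_cases ht : Sum.inl t ∈ B
        · rw [extendZero_of_mem _ ht]
          change TrivSqZeroExt.inl 0 + TrivSqZeroExt.inr 
            (if (⟨Sum.inl t, ht⟩ : B) = ⟨Sum.inl j, hj⟩ then 1 else 0) = _
          simp only [TrivSqZeroExt.inl_zero, zero_add, Subtype.mk.injEq, Sum.inl.injEq]
          split_ifs
          exacts [rfl, TrivSqZeroExt.inr_zero _]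
        · rw [extendZero_of_notMem _ ht, if_neg]
          rintro rfl
          exact ht hj
      have hsum : ∑ m : orderExponents d k 0 1, monomial m.1.1 (extendZero B q (Sum.inr m)) =
          monomial e₁.1 (1 : DualNumber ℂ) + monomial e₂.1 1 := by
        have (m : orderExponents d k 0 1) : monomial m.1.1 (extendZero B q (Sum.inr m)) =
            (if m = ⟨e₁, he₁⟩ then monomial e₁.1 (1 : DualNumber ℂ) else 0) +
              if m = ⟨e₂, he₂⟩ then monomial e₂.1 1 else 0 := by
          rw [hinr]
          by_cases h1 : m = ⟨e₁, he₁⟩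
          · subst h1
            simp [p, he]
          · by_cases h2 : m = ⟨e₂, he₂⟩
            · subst h2
              simp [p, he.symm]
            · rw [if_neg h1, if_neg h2]
              have h1' : m.1 ≠ e₁ := fun h => h1 (Subtype.ext h)
              have h2' : m.1 ≠ e₂ := fun h => h2 (Subtype.ext h)
              simp [p, h1', h2']
        rw [Finset.sum_congr rfl fun m _ => this m, Finset.sum_add_distrib]
        simp
      rw [hsum, linSub_chartMatrix _ (fun s t => by
        rw [hinl, hinl]
        split_ifs <;> simp) hk hkd]
      simp only [hinl, coeff_add, coeff_sum, coeff_C_mul, coeff_monomial, TrivSqZeroExt.snd_add,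
        ite_mul, zero_mul, Finset.sum_ite_eq', Finset.mem_univ, if_true]
      have hone (P : Prop) [Decidable P] :
          (if P then (1 : DualNumber ℂ) else 0).snd = 0 := by
        split_ifs <;> simp
      rw [hone, hone, zero_add, zero_add]
      by_cases hij : i = ⟨Sum.inl j, hj⟩
      · subst hij
        rw [if_pos rfl, if_pos]
        · simp
        · rfl
      · rw [if_neg hij, if_neg, mul_zero, TrivSqZeroExt.snd_zero]
        exact fun h => hij (Subtype.ext (hc' (Subtype.ext h : c' (Sum.inl j) = c' i.1)).symm)
    · have hzero : (fun t => extendZero B q (Sum.inl t)) = 0 := by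
        funext t
        by_cases ht : Sum.inl t ∈ B
        · rw [extendZero_of_mem _ ht]
          simp [q, p]
        · rw [extendZero_of_notMem _ ht]
          rfl
      rw [hzero, chartMatrix_zero, linSub_one]
      obtain ⟨i | i, hi'⟩ := i
      · refine (congrArg TrivSqZeroExt.snd (coeff_sum_monomial_of_notMem _
          (tangentExponent_notMem hk hkd i))).trans ?_
        rw [TrivSqZeroExt.snd_zero, if_neg]
        simp
      · refine (congrArg TrivSqZeroExt.snd (coeff_sum_monomial _ i.2)).trans ?_
        refine (congrArg TrivSqZeroExt.snd hi).trans ?_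
        rw [hsnd]
        rfl

/-- The dimension of the family of surfaces with a line of multiplicity `k`. -/
theorem le_topologicalKrullDim_singL {k : ℕ} (hk : 1 ≤ k) (hkd : k ≤ d) (h : 4 ≤ d ∨ 2 ≤ k) :
    ((Nat.card (orderExponents d k 0 1) + 3 : ℕ) : WithBot ℕ∞) ≤
      topologicalKrullDim (SingL k d) := by
  set M := orderExponents d k 0 1
  -- Coefficients are numbered before line parameters, so that the initial segments `B i` satisfy
  -- the hypothesis `hB` of `jacobian_genParam`.
  let e : Fin 4 ⊕ M ≃ Fin (Nat.card M + 3 + 1) := (Equiv.sumComm _ _).trans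
    (((Finite.equivFin M).sumCongr (Equiv.refl (Fin 4))).trans finSumFinEquiv)
  have he_inr (m) : (e (Sum.inr m) : ℕ) < Nat.card M := (Finite.equivFin M m).isLt
  have he_inl (t) : Nat.card M ≤ (e (Sum.inl t) : ℕ) := Nat.le_add_right _ _
  let B (i : Fin (Nat.card M + 3 + 1)) : Set (Fin 4 ⊕ M) := {s | e s ≤ i}
  refine le_topologicalKrullDim (Nat.card M + 3) (σ := fun i => B i)
    (fun i n => restrictVars (B i) (genParam (chartMatrix X) M n)) (fun i => ?_)
    (fun i => restrictVars_genParam_scaleStable _ _ _)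
    (fun i => (paramSet_restrictVars_subset _ _).trans (paramSet_genParam_subset_singL _ k))
    (fun i => paramSet_restrictVars_mono _ fun s hs => le_trans hs i.castSucc_le_succ)
    fun i => jacobian_genParam hk hkd h (B i) fun t ht m => ?_
  · have : Nat.card (B i) = Nat.card (Set.Iic i) :=
      Nat.card_congr (e.subtypeEquiv fun s => Iff.rfl)
    rw [this, Nat.card_eq_fintype_card, Fintype.card_ofFinset (Finset.Iic i)
      fun _ => by rw [Finset.mem_Iic, Set.mem_Iic], Fin.card_Iic]
  · have h1 : (e (Sum.inl t) : ℕ) ≤ i := ht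
    have h2 := he_inr m
    have h3 := he_inl t
    change (e (Sum.inr m) : ℕ) ≤ i
    omega

end Jacobian


end LineSurfaces

/-! ### The dimension inequality and generic uniqueness. -/

/-- The locus `DoubL k d` need not be Zariski closed; the variety it defines is its closure.
The first conjunct also bounds the dimension of `DoubL k d` itself, which is at most that of its
closure. -/
theorem mainTheorem5 (k d : ℕ) (hk : 1 ≤ k) (hkd : k ≤ d) (h : 4 ≤ d ∨ 2 ≤ k) :
    topologicalKrullDim (closure (LineSurfaces.DoubL k d)) <
        topologicalKrullDim (LineSurfaces.SingL k d) ∧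
      ∃ U : Set (LineSurfaces.SingL k d), IsOpen U ∧ Dense U ∧
        ∀ S ∈ U, ∃! l : Submodule ℂ (Fin 4 → ℂ),
          LineSurfaces.IsLine l ∧ S.1.ContainsToOrder k l := by
  open LineSurfaces in
  have hdim : topologicalKrullDim (closure (DoubL k d)) < topologicalKrullDim (SingL k d) :=
    (coveredByFamilies_doubL hk hkd h).krullDim_lt.trans_le (le_topologicalKrullDim_singL hk hkd h)
  refine ⟨hdim, Subtype.val ⁻¹' (closure (DoubL k d))ᶜ,
    isClosed_closure.isOpen_compl.preimage continuous_subtype_val, ?_, fun S hS => ?_⟩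
  -- Otherwise `SingL k d` would embed in the closure of `DoubL k d`, against the dimension
  -- inequality.
  · obtain ⟨S, hS, hSD⟩ : ∃ S ∈ SingL k d, S ∉ closure (DoubL k d) := by
      by_contra! hc
      exact hdim.not_ge (Topology.IsEmbedding.inclusion hc).isInducing.topologicalKrullDim_le
    have hirr : IsPreirreducible (Set.univ : Set (SingL k d)) := by
      have := isPreirreducible_preimage_val subset_rfl (isPreirreducible_singL (d := d) k)
      rwa [Subtype.coe_preimage_self] at this
    have : PreirreducibleSpace (SingL k d) := ⟨hirr⟩
    exact (isClosed_closure.isOpen_compl.preimage continuous_subtype_val).dense ⟨⟨S, hS⟩, hSD⟩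
  · obtain ⟨l, hl, hlS⟩ := S.2
    refine ⟨l, ⟨hl, hlS⟩, fun l' hl' => ?_⟩
    by_contra hne
    exact hS (subset_closure ⟨l', l, hl'.1, hl, hne, hl'.2, hlS⟩)
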